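/- Let $\Theta\subseteq\mathbb{R}$ be a non-degenerate closed interval (the whole line, a closed half-line, or a compact interval with non-empty interior), let $\mathcal{P}(\Theta)$ be the set of Borel probability measures on $\Theta$, and, for $p\in[1,\infty)$, let $\mathcal{P}_p(\Theta)$ be the set of those with finite $p$-th moment. For an integer $n\ge 1$ let $\mathcal{H}_n=\{H_{j,2l-1}: 1\le j\le n+1,\ 1\le l\le 2^{j-1}\}$ be a collection of probability measures on $\Theta$. A random probability measure $G$ on $\Theta$ is called $\mathrm{DSBA}(n,\mathcal{H}_n)$ if there is a random array $\{\mu_{j,l}: 1\le j\le n+1,\ 1\le l\le 2^j-1\}$ in $\Theta$ (with the conventions $\mu_{j,0}=\inf\Theta$, $\mu_{j,2^j}=\sup\Theta$) such that - $\mu_{1,1}\sim H_{1,1}$; - almost surely $\mu_{j,2l}=\mu_{j-1,l}$ for $2\le j\le n+1$, $1\le l\le 2^{j-1}-1$; - for $2\le j\le n+1$, conditionally on row $j-1$, the variables $\mu_{j,2l-1}$, $1\le l\le 2^{j-1}$, are independent, $\mu_{j,2l-1}$ having law $H_{j,2l-1}$ conditioned on the interval $(\mu_{j-1,l-1},\mu_{j-1,l}]$;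 - almost surely $G=\sum_{l=1}^{2^n} w_{n,l}\,\delta_{\mu_{n+1,2l-1}}$, where $w_{n,l}=F_{n,l}-F_{n,l-1}$ and the numbers $F_{j,l}$ ($0\le j\le n$, $0\le l\le 2^j$) are given by $F_{0,0}=0$, $F_{0,1}=1$ and, for $1\le j\le n$, $F_{j,2l}=F_{j-1,l}$ for $0\le l\le 2^{j-1}$ and $$F_{j,2l-1}=F_{j-1,l-1}+\bigl(F_{j-1,l}-F_{j-1,l-1}\bigr)\,\frac{\mu_{j+1,4l-1}-\mu_{j+1,4l-2}}{\mu_{j+1,4l-1}-\mu_{j+1,4l-3}},\qquad 1\le l\le 2^{j-1},$$ with the convention $0/0=1$. **Theorem.** Let $n$ be a random variable with values in $\{1,2,\dots\}$ that takes each of these values with positive probability. For each value of $n$ let $\mathcal{H}_n=\{H_{j,2l-1}\}$ be a collection as above in which every measure is absolutely continuous with respect to Lebesgue measure and has support $\Theta$. Let $G$ be a random probability measure on $\Theta$ which, given $n$, is $\mathrm{DSBA}(n,\mathcal{H}_n)$. Then: (i) $G$ is (almost surely equal to) a random element of $\mathcal{P}(\Theta)$ with the weak topology, and the support of its law is the whole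 of $\mathcal{P}(\Theta)$. (ii) For every $p\in[1,\infty)$, $G$ is almost surely equal to a random element of $\mathcal{P}_p(\Theta)$ with the topology induced by the Wasserstein distance of order $p$, and the support of its law is the whole of $\mathcal{P}_p(\Theta)$. -/

import Mathlib

open MeasureTheory Set
open scoped ENNReal

noncomputable section

namespace DSBA

/-! ### The parameter space and the arrays -/

/-- The standing assumption on the parameter space: `Θ` is a non-degenerate closed interval of the
real line (the whole line, a closed half-line, or a compact interval with non-empty interior). -/
structure IsParameterSpace (Θ : Set ℝ) : Prop where
  isClosed : IsClosed Θ
  ordConnected : Θ.OrdConnected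
  nontrivial : Θ.Nontrivial

/-- Row `j` of an array with entries in `Θ`, extended by the conventions `μ_{j,0} = inf Θ` and
`μ_{j,2^j} = sup Θ` (extended real numbers). -/
def extRow {Θ : Set ℝ} (x : ℕ → ℕ → Θ) (j l : ℕ) : EReal :=
  if l = 0 then ⨅ θ : Θ, ((θ : ℝ) : EReal)
  else if l = 2 ^ j then ⨆ θ : Θ, ((θ : ℝ) : EReal)
  else ((x j l : ℝ) : EReal)

/-- The cell `(μ_{j,l-1}, μ_{j,l}]` of `Θ` determined by row `j` of an array, `1 ≤ l ≤ 2^j`. -/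
def cell {Θ : Set ℝ} (x : ℕ → ℕ → Θ) (j l : ℕ) : Set Θ :=
  {θ | extRow x j (l - 1) < ((θ : ℝ) : EReal) ∧ ((θ : ℝ) : EReal) ≤ extRow x j l}

/-- The quotient `a / b`, with the convention `0 / 0 = 1`. -/
def convRatio (a b : ℝ) : ℝ := if b = 0 then 1 else a / b

/-- The inversion formula: `invCdf x j k` is the value `G(μ_{j,k})`, `0 ≤ k ≤ 2^j`, of the
distribution function computed from the array `x`. At level `0` it is `0` at `k = 0` (the point
`inf Θ`) and `1` at `k = 1` (the point `sup Θ`). At level `j + 1`, even positions are inherited,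
and at an odd position `k = 2 l - 1`, where `l - 1 = k / 2`, one has
`G(μ_{j+1,2l-1}) = G(μ_{j,l-1}) + [G(μ_{j,l}) - G(μ_{j,l-1})] *
  (μ_{j+2,4l-1} - μ_{j+2,4l-2}) / (μ_{j+2,4l-1} - μ_{j+2,4l-3})`. -/
def invCdf {Θ : Set ℝ} (x : ℕ → ℕ → Θ) : ℕ → ℕ → ℝ
  | 0, k => if k = 0 then 0 else 1
  | j + 1, k =>
    if k % 2 = 0 then invCdf x j (k / 2)
    else
      let l := k / 2 + 1
      invCdf x j (l - 1) + (invCdf x j l - invCdf x j (l - 1)) *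
        convRatio ((x (j + 2) (4 * l - 1) : ℝ) - (x (j + 2) (4 * l - 2) : ℝ))
          ((x (j + 2) (4 * l - 1) : ℝ) - (x (j + 2) (4 * l - 3) : ℝ))

/-- The weight `w_{n,l} = G(μ_{n,l}) - G(μ_{n,l-1})` of the `l`-th cell at level `n`. -/
def weight {Θ : Set ℝ} (x : ℕ → ℕ → Θ) (n l : ℕ) : ℝ := invCdf x n l - invCdf x n (l - 1)

/-- The discrete measure `∑_{l=1}^{2^n} w_{n,l} δ_{μ_{n+1,2l-1}}` attached to an array. -/
def arrayMeasure {Θ : Set ℝ} (n : ℕ) (x : ℕ → ℕ → Θ) : Measure Θ :=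
  ∑ l ∈ Finset.Icc 1 (2 ^ n),
    ENNReal.ofReal (weight x n l) • Measure.dirac (x (n + 1) (2 * l - 1))

/-! ### Random discrete SBA measures -/

/-- The σ-algebra generated by the entries `1, …, 2^j - 1` of row `j` of a random array (under the
inheritance rule, row `j` contains all the earlier rows). -/
@[reducible] def rowSigma {Ω : Type*} {Θ : Set ℝ} (M : Ω → ℕ → ℕ → Θ) (j : ℕ) : MeasurableSpace Ω :=
  ⨆ l ∈ Finset.Ico 1 (2 ^ j), MeasurableSpace.comap (fun ω => M ω j l) inferInstance

/-- Under the probability measure `P`, the random array `M` (of which only the entries `M ω j l` with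
`1 ≤ j ≤ n + 1` and `1 ≤ l ≤ 2^j - 1` matter) is the random barycenter array with parameters
`(n, H)`; the measure `H_{j,2l-1}` is `H j (2 * l - 1)`.

The field `cond_odd` says that, conditionally on row `j - 1`, the odd entries `μ_{j,2l-1}` of row `j`
are independent, with law `H_{j,2l-1}` conditioned on the interval `(μ_{j-1,l-1}, μ_{j-1,l}]`. -/
structure IsRandomArray {Ω : Type*} [MeasurableSpace Ω] {Θ : Set ℝ} (P : Measure Ω) (n : ℕ)
    (H : ℕ → ℕ → ProbabilityMeasure Θ) (M : Ω → ℕ → ℕ → Θ) : Prop where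
  measurable : ∀ j ∈ Finset.Icc 1 (n + 1), ∀ l ∈ Finset.Ico 1 (2 ^ j),
    Measurable (fun ω => M ω j l)
  law_root : P.map (fun ω => M ω 1 1) = (H 1 1 : Measure Θ)
  even : ∀ j ∈ Finset.Icc 2 (n + 1), ∀ l ∈ Finset.Ico 1 (2 ^ (j - 1)),
    ∀ᵐ ω ∂P, M ω j (2 * l) = M ω (j - 1) l
  cond_odd : ∀ j ∈ Finset.Icc 2 (n + 1),
    ∀ A : Set Ω, MeasurableSet[rowSigma M (j - 1)] A →
    ∀ B : ℕ → Set Θ, (∀ l, MeasurableSet (B l)) →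
      P (A ∩ ⋂ l ∈ Finset.Icc 1 (2 ^ (j - 1)), {ω | M ω j (2 * l - 1) ∈ B l}) =
        ∫⁻ ω in A, ∏ l ∈ Finset.Icc 1 (2 ^ (j - 1)),
          ProbabilityTheory.cond (H j (2 * l - 1) : Measure Θ) (cell (M ω) (j - 1) l) (B l) ∂P

/-- Under `P`, the random probability measure `G` is a discrete SBA random probability measure with
parameters `(n, H)`. -/
def IsDSBA {Ω : Type*} [MeasurableSpace Ω] {Θ : Set ℝ} (P : Measure Ω) (n : ℕ)
    (H : ℕ → ℕ → ProbabilityMeasure Θ) (G : Ω → ProbabilityMeasure Θ) : Prop :=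
  ∃ M : Ω → ℕ → ℕ → Θ, IsRandomArray P n H M ∧
    ∀ᵐ ω ∂P, (G ω : Measure Θ) = arrayMeasure n (M ω)

/-! ### Wasserstein spaces -/

/-- The Wasserstein distance of order `p` (with values in `[0, ∞]`): the infimum of the transport
cost over all couplings. -/
def wasserstein {Θ : Set ℝ} (p : ℝ) (G₁ G₂ : ProbabilityMeasure Θ) : ℝ≥0∞ :=
  ⨅ γ ∈ {γ : Measure (Θ × Θ) |
      γ.map Prod.fst = (G₁ : Measure Θ) ∧ γ.map Prod.snd = (G₂ : Measure Θ)},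
    (∫⁻ z, ENNReal.ofReal |(z.1 : ℝ) - (z.2 : ℝ)| ^ p ∂γ) ^ (1 / p)

/-- `P_p(Θ)`: the probability measures on `Θ` with finite `p`-th moment. -/
def Pp (Θ : Set ℝ) (p : ℝ) : Type :=
  {G : ProbabilityMeasure Θ // ∫⁻ θ, ENNReal.ofReal |(θ : ℝ)| ^ p ∂(G : Measure Θ) < ∞}

/-- The metric topology of the Wasserstein distance of order `p` on `P_p(Θ)`: a set is open when it
contains, with each of its points, a ball around that point. -/
instance (Θ : Set ℝ) (p : ℝ) : TopologicalSpace (Pp Θ p) where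
  IsOpen U := ∀ G₀ ∈ U, ∃ ε : ℝ, 0 < ε ∧
    ∀ G : Pp Θ p, wasserstein p G.1 G₀.1 < ENNReal.ofReal ε → G ∈ U
  isOpen_univ := fun _ _ => ⟨1, one_pos, fun _ _ => mem_univ _⟩
  isOpen_inter := by
    intro s t hs ht G₀ hG
    obtain ⟨a, ha, has⟩ := hs G₀ hG.1
    obtain ⟨b, hb, hbt⟩ := ht G₀ hG.2
    refine ⟨min a b, lt_min ha hb, fun G h => ⟨has G (h.trans_le ?_), hbt G (h.trans_le ?_)⟩⟩
    · exact ENNReal.ofReal_le_ofReal (min_le_left _ _)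
    · exact ENNReal.ofReal_le_ofReal (min_le_right _ _)
  isOpen_sUnion := by
    intro S hS G₀ ⟨U, hU, hG⟩
    obtain ⟨a, ha, haU⟩ := hS U hU G₀ hG
    exact ⟨a, ha, fun G h => ⟨U, hU, haU G h⟩⟩

/-! ### Support of a random element -/

/-- The random element `X` of the topological space `E` is measurable for the Borel σ-algebra (up to
a null set), and the support of its law is the whole of `E`. -/
def HasFullSupport {Ω E : Type*} [MeasurableSpace Ω] [TopologicalSpace E] (P : Measure Ω)
    (X : Ω → E) : Prop :=
  @AEMeasurable Ω E (borel E) _ X P ∧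
    @Measure.support E _ (borel E) (@Measure.map Ω E _ (borel E) X P) = univ

end DSBA

end

namespace DSBA

/-! Finitely supported measures are dense in both spaces and depend continuously on their weights
and points. It therefore suffices that, with positive probability, the weights and points of `G`
come arbitrarily close to those of a dense family of such measures.

A finitely supported measure becomes a possible value of `G` by recursive cutting at barycenters:
cut the support at its mean, each half at its own mean, and so on. As long as two distinct points
remain, both sides of a cut are nonempty, so the process is finite. A single remaining atom is cut
into two copies of half the mass, which brings all branches to a common depth `n`
(`exists_barySplit`). The splitting so obtained is only weak; pushing the two halves of each block
apart without moving its barycenter makes it strict (`BarySplit.exists_strict`).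

For a strict splitting, the barycenters of the dyadic blocks form a strictly nested array. If a
block of mass `S` and barycenter `b` has a left half of mass `s₁`, and its halves have barycenters
`b₁ < b < b₂`, then `s₁ / S = (b₂ - b) / (b₂ - b₁)`. Hence the inversion formula returns the given
weights (`BarySplit.realInvCdf_baryArray`), and it is continuous near this array because the
denominators do not vanish (`tendsto_arrayParam`). The random array charges every neighbourhood of a
strictly nested array in the interior of `Θ`: near that array, each entry has a fully supported law
conditioned on a cell that contains a neighbourhood of the target
(`IsRandomArray.measure_rowNear_pos`).

The event that the random depth equals `n` is enough, since conditioning on it gives a measure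
absolutely continuous with respect to `P`. Both claims are instances of `hasFullSupport_of_dense`,
for a map `J` from probability measures to the target space. -/

/-! ### Barycenter splittings of weighted sequences of points -/

/-- The barycenter of the first `2 ^ n` points of the sequence `A`, with weights `W`. -/
noncomputable def bary (n : ℕ) (W A : ℕ → ℝ) : ℝ :=
  (∑ i ∈ Finset.range (2 ^ n), W i * A i) / ∑ i ∈ Finset.range (2 ^ n), W i

/-- In every dyadic block of the first `2 ^ n` points of `A`, the barycenter separates the two
halves of the block, in the sense of the relation `r`. -/
def BarySplit (r : ℝ → ℝ → Prop) : ℕ → (ℕ → ℝ) → (ℕ → ℝ) → Prop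
  | 0, _, _ => True
  | n + 1, W, A => BarySplit r n W A ∧
      BarySplit r n (fun i => W (i + 2 ^ n)) (fun i => A (i + 2 ^ n)) ∧
      ∀ i < 2 ^ n, r (A i) (bary (n + 1) W A) ∧ r (bary (n + 1) W A) (A (i + 2 ^ n))

lemma sum_range_two_pow_succ (n : ℕ) (f : ℕ → ℝ) :
    ∑ i ∈ Finset.range (2 ^ (n + 1)), f i =
      ∑ i ∈ Finset.range (2 ^ n), f i + ∑ i ∈ Finset.range (2 ^ n), f (i + 2 ^ n) := by
  rw [pow_succ, mul_two, Finset.sum_range_add]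
  simp only [add_comm]

lemma sum_range_two_pow_pos {W : ℕ → ℝ} (hW : ∀ i, 0 < W i) (n : ℕ) :
    0 < ∑ i ∈ Finset.range (2 ^ n), W i :=
  Finset.sum_pos (fun i _ => hW i) ⟨0, by simp⟩

lemma bary_congr {n : ℕ} {W W' A A' : ℕ → ℝ} (hW : ∀ i < 2 ^ n, W i = W' i)
    (hA : ∀ i < 2 ^ n, A i = A' i) : bary n W A = bary n W' A' := by
  unfold bary
  congr 1
  · exact Finset.sum_congr rfl fun i hi => by
      rw [hW i (Finset.mem_range.1 hi), hA i (Finset.mem_range.1 hi)]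
  · exact Finset.sum_congr rfl fun i hi => hW i (Finset.mem_range.1 hi)

lemma bary_zero {W : ℕ → ℝ} (hW : ∀ i, 0 < W i) (A : ℕ → ℝ) : bary 0 W A = A 0 := by
  have := (hW 0).ne'
  simp [bary]
  field_simp

lemma BarySplit.congr {r : ℝ → ℝ → Prop} {n : ℕ} : ∀ {W W' A A' : ℕ → ℝ},
    BarySplit r n W A → (∀ i < 2 ^ n, W i = W' i) → (∀ i < 2 ^ n, A i = A' i) →
    BarySplit r n W' A' := by
  induction n with
  | zero => intros; trivial
  | succ n ih =>
    intro W W' A A' h hW hA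
    have h2 : 2 ^ (n + 1) = 2 ^ n + 2 ^ n := by rw [pow_succ, mul_two]
    refine ⟨ih h.1 (fun i hi => hW i (by omega)) (fun i hi => hA i (by omega)),
      ih h.2.1 (fun i hi => hW _ (by omega)) (fun i hi => hA _ (by omega)), fun i hi => ?_⟩
    rw [← bary_congr hW hA, ← hA i (by omega), ← hA (i + 2 ^ n) (by omega)]
    exact h.2.2 i hi

lemma bary_add_const {W : ℕ → ℝ} (hW : ∀ i, 0 < W i) (n : ℕ) (A : ℕ → ℝ) (c : ℝ) :
    bary n W (fun i => A i + c) = bary n W A + c := by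
  have := (sum_range_two_pow_pos hW n).ne'
  unfold bary
  simp only [mul_add, Finset.sum_add_distrib, ← Finset.sum_mul]
  field_simp

lemma BarySplit.add_const {n : ℕ} (c : ℝ) : ∀ {W A : ℕ → ℝ}, (∀ i, 0 < W i) →
    BarySplit (· < ·) n W A → BarySplit (· < ·) n W (fun i => A i + c) := by
  induction n with
  | zero => intros; trivial
  | succ n ih =>
    intro W A hW h
    refine ⟨ih hW h.1, ih (fun i => hW _) h.2.1, fun i hi => ?_⟩
    rw [bary_add_const hW]
    simpa using h.2.2 i hi

lemma bary_lt {n : ℕ} {W A : ℕ → ℝ} (hW : ∀ i, 0 < W i) {c : ℝ} (h : ∀ i < 2 ^ n, A i < c) :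
    bary n W A < c := by
  rw [bary, div_lt_iff₀ (sum_range_two_pow_pos hW n), Finset.mul_sum]
  refine Finset.sum_lt_sum_of_nonempty ⟨0, by simp⟩ fun i hi => ?_
  rw [mul_comm]
  exact mul_lt_mul_of_pos_right (h i (Finset.mem_range.1 hi)) (hW i)

lemma lt_bary {n : ℕ} {W A : ℕ → ℝ} (hW : ∀ i, 0 < W i) {c : ℝ} (h : ∀ i < 2 ^ n, c < A i) :
    c < bary n W A := by
  rw [bary, lt_div_iff₀ (sum_range_two_pow_pos hW n), Finset.mul_sum]
  refine Finset.sum_lt_sum_of_nonempty ⟨0, by simp⟩ fun i hi => ?_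
  rw [mul_comm c]
  exact mul_lt_mul_of_pos_left (h i (Finset.mem_range.1 hi)) (hW i)

lemma abs_bary_sub_bary_le {n : ℕ} {W A B : ℕ → ℝ} (hW : ∀ i, 0 < W i) {δ : ℝ}
    (h : ∀ i, |B i - A i| ≤ δ) : |bary n W B - bary n W A| ≤ δ := by
  have hS := sum_range_two_pow_pos hW n
  rw [bary, bary, ← sub_div, abs_div, abs_of_pos hS, div_le_iff₀ hS, ← Finset.sum_sub_distrib,
    Finset.mul_sum]
  refine (Finset.abs_sum_le_sum_abs _ _).trans (Finset.sum_le_sum fun i _ => ?_)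
  rw [← mul_sub, abs_mul, abs_of_pos (hW i), mul_comm]
  exact mul_le_mul_of_nonneg_right (h i) (hW i).le

/-- Weak barycenter splittings become strict after a small perturbation of the points. -/
lemma BarySplit.exists_strict {n : ℕ} : ∀ {W A : ℕ → ℝ}, (∀ i, 0 < W i) →
    BarySplit (· ≤ ·) n W A → ∀ δ > 0, ∃ B : ℕ → ℝ, (∀ i, |B i - A i| ≤ δ) ∧
      BarySplit (· < ·) n W B := by
  induction n with
  | zero => exact fun {W A} _ _ δ hδ => ⟨A, by simp [hδ.le], trivial⟩
  | succ n ih =>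
    intro W A hW h δ hδ
    set l := ∑ i ∈ Finset.range (2 ^ n), W i with hl
    set r := ∑ i ∈ Finset.range (2 ^ n), W (i + 2 ^ n) with hr
    have hl0 : 0 < l := sum_range_two_pow_pos hW n
    have hr0 : 0 < r := sum_range_two_pow_pos (fun i => hW _) n
    -- This choice of `η` keeps the two shifts `η * r` and `η * l` below `δ / 2`.
    obtain ⟨η, hη, hηδ⟩ : ∃ η > 0, η * (l + r) = δ / 2 :=
      ⟨δ / 2 / (l + r), by positivity, by field_simp⟩
    have hηl : 0 < η * l := by positivity
    have hηr : 0 < η * r := by positivity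
    have hadd : η * l + η * r = δ / 2 := by rw [← hηδ]; ring
    -- A third suffices: a left point, at most `m + δ' - η * r` with `m` the old barycenter, must
    -- stay below the new barycenter, which is at least `m - δ'`; so `2 * δ' < η * r` is needed, and
    -- symmetrically on the right.
    set δ' := min (η * l) (η * r) / 3 with hδ'
    have hδ'0 : 0 < δ' := by positivity
    have h1 : δ' ≤ η * l / 3 := div_le_div_of_nonneg_right (min_le_left _ _) (by norm_num)
    have h2 : δ' ≤ η * r / 3 := div_le_div_of_nonneg_right (min_le_right _ _) (by norm_num)
    obtain ⟨BL, hBL, hBLs⟩ := ih hW h.1 δ' hδ'0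
    obtain ⟨BR, hBR, hBRs⟩ := ih (fun i => hW _) h.2.1 δ' hδ'0
    let C : ℕ → ℝ := fun i => if i < 2 ^ n then BL i else BR (i - 2 ^ n)
    -- Each half is shifted in proportion to the mass of the other, so the total moment changes by
    -- `-l * (η * r) + r * (η * l) = 0` and the barycenter stays that of `C`.
    let B : ℕ → ℝ := fun i => if i < 2 ^ n then BL i + -(η * r) else BR (i - 2 ^ n) + η * l
    have hC : ∀ i, |C i - A i| ≤ δ' := by
      intro i
      by_cases hi : i < 2 ^ n
      · simpa [C, hi] using hBL i
      · have := hBR (i - 2 ^ n)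
        rw [Nat.sub_add_cancel (not_lt.1 hi)] at this
        simpa [C, hi] using this
    have hBL' : ∀ i < 2 ^ n, BL i + -(η * r) = B i := fun i hi => by simp [B, hi]
    have hBR' : ∀ i, BR i + η * l = B (i + 2 ^ n) := fun i => by simp [B]
    have hbary : bary (n + 1) W B = bary (n + 1) W C := by
      unfold bary
      congr 1
      rw [sum_range_two_pow_succ, sum_range_two_pow_succ]
      have e1 : ∑ i ∈ Finset.range (2 ^ n), W i * B i =
          ∑ i ∈ Finset.range (2 ^ n), W i * C i - l * (η * r) := by
        rw [hl, Finset.sum_mul, ← Finset.sum_sub_distrib]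
        refine Finset.sum_congr rfl fun i hi => ?_
        have hi := Finset.mem_range.1 hi
        simp only [B, C, hi, if_true]; ring
      have e2 : ∑ i ∈ Finset.range (2 ^ n), W (i + 2 ^ n) * B (i + 2 ^ n) =
          ∑ i ∈ Finset.range (2 ^ n), W (i + 2 ^ n) * C (i + 2 ^ n) + r * (η * l) := by
        rw [hr, Finset.sum_mul, ← Finset.sum_add_distrib]
        refine Finset.sum_congr rfl fun i hi => ?_
        simp [B, C]; ring
      rw [e1, e2]; ring
    have hb := abs_bary_sub_bary_le (n := n + 1) hW hC
    rw [← hbary, abs_le] at hb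
    refine ⟨B, fun i => ?_, ?_, ?_, fun i hi => ⟨?_, ?_⟩⟩
    · have := abs_le.1 (hC i)
      rw [abs_le]
      by_cases hi : i < 2 ^ n
      · simp only [C, B, hi, if_true] at this ⊢
        constructor <;> linarith
      · simp only [C, B, hi, if_false] at this ⊢
        constructor <;> linarith
    · exact (hBLs.add_const _ hW).congr (fun _ _ => rfl) hBL'
    · exact (hBRs.add_const _ fun i => hW _).congr (fun _ _ => rfl) fun i _ => hBR' i
    · have := abs_le.1 (hBL i)
      have := (h.2.2 i hi).1
      rw [← hBL' i hi]
      linarith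
    · have := abs_le.1 (hBR i)
      have := (h.2.2 i hi).2
      rw [← hBR' i]
      linarith

/-- By `hm`, the number `m` is the barycenter of the concatenation, so the only new condition is
that `m` separates the two pieces. -/
lemma BarySplit.append {n : ℕ} {W A W' A' : ℕ → ℝ} (h : BarySplit (· ≤ ·) n W A)
    (h' : BarySplit (· ≤ ·) n W' A') {m : ℝ}
    (hm : m * (∑ i ∈ Finset.range (2 ^ n), W i + ∑ i ∈ Finset.range (2 ^ n), W' i) =
      ∑ i ∈ Finset.range (2 ^ n), W i * A i + ∑ i ∈ Finset.range (2 ^ n), W' i * A' i)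
    (hW : ∀ i, 0 < W i) (hW' : ∀ i, 0 < W' i) (hA : ∀ i, A i ≤ m) (hA' : ∀ i, m ≤ A' i) :
    BarySplit (· ≤ ·) (n + 1) (fun i => if i < 2 ^ n then W i else W' (i - 2 ^ n))
      (fun i => if i < 2 ^ n then A i else A' (i - 2 ^ n)) := by
  have hb : bary (n + 1) (fun i => if i < 2 ^ n then W i else W' (i - 2 ^ n))
      (fun i => if i < 2 ^ n then A i else A' (i - 2 ^ n)) = m := by
    have hl := sum_range_two_pow_pos hW n
    have hr := sum_range_two_pow_pos hW' n
    have e : ∀ f f' : ℕ → ℝ, ∑ i ∈ Finset.range (2 ^ n), (if i < 2 ^ n then f i else f' i) =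
        ∑ i ∈ Finset.range (2 ^ n), f i := fun f f' =>
      Finset.sum_congr rfl fun i hi => by simp [Finset.mem_range.1 hi]
    unfold bary
    simp only [sum_range_two_pow_succ, ite_mul, mul_ite]
    rw [div_eq_iff]
    · rw [Finset.sum_congr rfl (g := fun i => W i * A i), Finset.sum_congr rfl
        (s₁ := Finset.range (2 ^ n)) (f := fun i => if i < 2 ^ n then W i else _) (g := W)]
      · simpa using hm.symm
      · intro i hi; simp [Finset.mem_range.1 hi]
      · intro i hi; simp [Finset.mem_range.1 hi]
    · simp only [e]; simp; positivity
  refine ⟨h.congr (fun i hi => by simp [hi]) (fun i hi => by simp [hi]), ?_, fun i hi => ?_⟩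
  · simpa using h'
  · rw [hb]
    simpa [hi] using ⟨hA i, hA' i⟩

/-- A finite measure on at most `n + 1` real points is carried by a sequence of `2 ^ n` points
with a weak barycenter splitting. -/
lemma exists_barySplit (n : ℕ) : ∀ (s : Finset ℝ) (w : ℝ → ℝ), s.Nonempty → s.card ≤ n + 1 →
    (∀ x ∈ s, 0 < w x) → ∃ W A : ℕ → ℝ, (∀ i, 0 < W i) ∧ (∀ i, A i ∈ s) ∧
      BarySplit (· ≤ ·) n W A ∧
      ∀ f : ℝ → ℝ, ∑ i ∈ Finset.range (2 ^ n), W i * f (A i) = ∑ x ∈ s, w x * f x := by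
  induction n with
  | zero =>
    intro s w hs hc hw
    obtain ⟨x, rfl⟩ := Finset.card_eq_one.1 (le_antisymm hc hs.card_pos)
    exact ⟨fun _ => w x, fun _ => x, by simpa using hw, by simp, trivial, by simp⟩
  | succ n ih =>
    intro s w hs hc hw
    obtain ⟨s₁, s₂, w₁, w₂, m, hs₁, hs₂, hsub₁, hsub₂, hc₁, hc₂, hw₁, hw₂, hle₁, hle₂, hsum, hm⟩ :
        ∃ (s₁ s₂ : Finset ℝ) (w₁ w₂ : ℝ → ℝ) (m : ℝ), s₁.Nonempty ∧ s₂.Nonempty ∧ s₁ ⊆ s ∧ s₂ ⊆ s ∧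
          s₁.card ≤ n + 1 ∧ s₂.card ≤ n + 1 ∧ (∀ x ∈ s₁, 0 < w₁ x) ∧ (∀ x ∈ s₂, 0 < w₂ x) ∧
          (∀ x ∈ s₁, x ≤ m) ∧ (∀ x ∈ s₂, m ≤ x) ∧
          (∀ f : ℝ → ℝ, ∑ x ∈ s₁, w₁ x * f x + ∑ x ∈ s₂, w₂ x * f x = ∑ x ∈ s, w x * f x) ∧
          m * ∑ x ∈ s, w x = ∑ x ∈ s, w x * x := by
      -- A single atom is duplicated with half its mass; this is where equality of points, and thus
      -- a merely weak splitting, enters.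
      by_cases hone : s.card = 1
      · obtain ⟨c, rfl⟩ := Finset.card_eq_one.1 hone
        have := hw c (by simp)
        exact ⟨{c}, {c}, fun x => w x / 2, fun x => w x / 2, c, by simp, by simp, by simp, by simp,
          by simp, by simp, by simpa using this, by simpa using this, by simp, by simp,
          fun f => by simp; ring, by simp [mul_comm]⟩
      · have hS : 0 < ∑ x ∈ s, w x := Finset.sum_pos hw hs
        set m := (∑ x ∈ s, w x * x) / ∑ x ∈ s, w x with hmdef
        have hm : m * ∑ x ∈ s, w x = ∑ x ∈ s, w x * x := by rw [hmdef]; field_simp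
        have hm' : ∑ x ∈ s, w x * (x - m) = 0 := by
          simp only [mul_sub, Finset.sum_sub_distrib, ← Finset.sum_mul]
          linarith
        have hsplit := fun f : ℝ → ℝ => Finset.sum_filter_add_sum_filter_not s (· ≤ m) f
        have hcard := Finset.card_filter_add_card_filter_not (s := s) (· ≤ m)
        -- The centred moments sum to zero with positive weights, so a point off the mean forces
        -- points on both sides. Each part then has fewer points than `s`, as the induction
        -- requires.
        have hex : ∃ x ∈ s, x ≠ m := by
          by_contra! hall
          refine hone (le_antisymm (Finset.card_le_one.2 fun a ha b hb => ?_) hs.card_pos)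
          rw [hall a ha, hall b hb]
        obtain ⟨z, hz, hzm⟩ := hex
        have hL : (s.filter (· ≤ m)).Nonempty := by
          by_contra hne
          rw [Finset.not_nonempty_iff_eq_empty, Finset.filter_eq_empty_iff] at hne
          have : 0 < ∑ x ∈ s, w x * (x - m) :=
            Finset.sum_pos (fun x hx => mul_pos (hw x hx) (by linarith [not_le.1 (hne hx)])) hs
          linarith
        have hR : (s.filter (¬ · ≤ m)).Nonempty := by
          by_contra hne
          rw [Finset.not_nonempty_iff_eq_empty, Finset.filter_eq_empty_iff] at hne
          have hle : ∀ x ∈ s, x ≤ m := fun x hx => not_not.1 (hne hx)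
          have : ∑ x ∈ s, w x * (x - m) < ∑ x ∈ s, (0 : ℝ) :=
            Finset.sum_lt_sum (fun x hx => mul_nonpos_of_nonneg_of_nonpos (hw x hx).le
              (by linarith [hle x hx])) ⟨z, hz, mul_neg_of_pos_of_neg (hw z hz)
              (by linarith [lt_of_le_of_ne (hle z hz) hzm])⟩
          simp [hm'] at this
        have := hL.card_pos
        have := hR.card_pos
        refine ⟨_, _, w, w, m, hL, hR, Finset.filter_subset _ _, Finset.filter_subset _ _,
          by omega, by omega, fun x hx => hw x (Finset.mem_filter.1 hx).1,
          fun x hx => hw x (Finset.mem_filter.1 hx).1, fun x hx => (Finset.mem_filter.1 hx).2,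
          fun x hx => (not_le.1 (Finset.mem_filter.1 hx).2).le, fun f => hsplit _, hm⟩
    obtain ⟨W₁, A₁, hW₁, hA₁, hsp₁, hf₁⟩ := ih s₁ w₁ hs₁ hc₁ hw₁
    obtain ⟨W₂, A₂, hW₂, hA₂, hsp₂, hf₂⟩ := ih s₂ w₂ hs₂ hc₂ hw₂
    refine ⟨fun i => if i < 2 ^ n then W₁ i else W₂ (i - 2 ^ n),
      fun i => if i < 2 ^ n then A₁ i else A₂ (i - 2 ^ n), fun i => ?_, fun i => ?_,
      hsp₁.append hsp₂ (m := m) ?_ hW₁ hW₂ (fun i => hle₁ _ (hA₁ i)) (fun i => hle₂ _ (hA₂ i)),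
      fun f => ?_⟩
    · dsimp only; split_ifs; exacts [hW₁ _, hW₂ _]
    · dsimp only; split_ifs; exacts [hsub₁ (hA₁ _), hsub₂ (hA₂ _)]
    · have e1 := hf₁ (fun _ => 1)
      have e2 := hf₂ (fun _ => 1)
      have e3 := hsum (fun _ => 1)
      have e4 := hf₁ id
      have e5 := hf₂ id
      have e6 := hsum id
      simp only [mul_one, id] at e1 e2 e3 e4 e5 e6
      rw [e1, e2, e3, e4, e5, e6, hm]
    · rw [sum_range_two_pow_succ, ← hsum f, ← hf₁, ← hf₂]
      congr 1
      · exact Finset.sum_congr rfl fun i hi => by simp [Finset.mem_range.1 hi]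
      · simp

/-- The splitting condition is a binary tree; descending `d` levels, turning right exactly when `2 ^
d ≤ l`, reaches the block with index `l`. -/
lemma BarySplit.block {r : ℝ → ℝ → Prop} {k : ℕ} (d : ℕ) : ∀ {W A : ℕ → ℝ} {l : ℕ}, l < 2 ^ d →
    BarySplit r (d + k) W A →
    BarySplit r k (fun i => W (i + l * 2 ^ k)) (fun i => A (i + l * 2 ^ k)) := by
  induction d with
  | zero =>
    intro W A l hl h
    obtain rfl : l = 0 := by simpa using hl
    simpa using h
  | succ d ih =>
    intro W A l hl h
    rw [show d + 1 + k = d + k + 1 by omega] at h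
    by_cases hld : l < 2 ^ d
    · exact ih hld h.1
    · have h2 : 2 ^ (d + 1) = 2 ^ d + 2 ^ d := by rw [pow_succ, mul_two]
      have := ih (l := l - 2 ^ d) (by omega) h.2.1
      have e : ∀ i, i + (l - 2 ^ d) * 2 ^ k + 2 ^ (d + k) = i + l * 2 ^ k := fun i => by
        rw [add_assoc, pow_add, ← add_mul, Nat.sub_add_cancel (not_lt.1 hld)]
      simpa only [e] using this

/-! ### Barycenter arrays of real numbers -/

/-- The inversion formula `invCdf` for arrays of real numbers. -/
noncomputable def realInvCdf (y : ℕ → ℕ → ℝ) : ℕ → ℕ → ℝ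
  | 0, k => if k = 0 then 0 else 1
  | j + 1, k =>
    if k % 2 = 0 then realInvCdf y j (k / 2)
    else
      let l := k / 2 + 1
      realInvCdf y j (l - 1) + (realInvCdf y j l - realInvCdf y j (l - 1)) *
        convRatio (y (j + 2) (4 * l - 1) - y (j + 2) (4 * l - 2))
          (y (j + 2) (4 * l - 1) - y (j + 2) (4 * l - 3))

lemma invCdf_eq_realInvCdf {Θ : Set ℝ} (x : ℕ → ℕ → Θ) (j : ℕ) :
    ∀ k, invCdf x j k = realInvCdf (fun j l => (x j l : ℝ)) j k := by
  induction j with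
  | zero => exact fun k => rfl
  | succ j ih => intro k; simp only [invCdf, realInvCdf, ih]

/-- The array of the barycenters of the dyadic blocks of the first `2 ^ n` points of `A`. -/
noncomputable def baryArray (n : ℕ) (W A : ℕ → ℝ) : ℕ → ℕ → ℝ
  | 0, _ => 0
  | j + 1, l =>
    if l % 2 = 0 then baryArray n W A j (l / 2)
    else bary (n - j) (fun i => W (i + l / 2 * 2 ^ (n - j))) (fun i => A (i + l / 2 * 2 ^ (n - j)))

lemma baryArray_even (n : ℕ) (W A : ℕ → ℝ) (j l : ℕ) :
    baryArray n W A (j + 1) (2 * l) = baryArray n W A j l := by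
  simp [baryArray]

lemma baryArray_odd (n : ℕ) (W A : ℕ → ℝ) (j l : ℕ) :
    baryArray n W A (j + 1) (2 * l + 1) =
      bary (n - j) (fun i => W (i + l * 2 ^ (n - j))) (fun i => A (i + l * 2 ^ (n - j))) := by
  rw [baryArray, if_neg (by omega), show (2 * l + 1) / 2 = l by omega]

lemma baryArray_last {n : ℕ} {W : ℕ → ℝ} (hW : ∀ i, 0 < W i) (A : ℕ → ℝ) (l : ℕ) :
    baryArray n W A (n + 1) (2 * l + 1) = A l := by
  rw [baryArray_odd, Nat.sub_self, bary_zero fun i => hW _]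
  simp

lemma sum_range_block (h l : ℕ) (f : ℕ → ℝ) :
    ∑ i ∈ Finset.range ((l + 1) * 2 ^ h), f i =
      ∑ i ∈ Finset.range (l * 2 ^ h), f i +
        ∑ i ∈ Finset.range (2 ^ h), f (i + l * 2 ^ h) := by
  rw [add_mul, one_mul, Finset.sum_range_add]
  simp only [add_comm]

/-- This translates the top condition of the subtree at block `m` of level `j` into array indices:
the halves of that block are the blocks `2 * m` and `2 * m + 1` of the next level. -/
lemma BarySplit.baryArray_block {n j m : ℕ} {W A : ℕ → ℝ} (h : BarySplit (· < ·) n W A)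
    (hj : j < n) (hm : m < 2 ^ j) :
    ∀ i < 2 ^ (n - (j + 1)),
      A (i + (2 * m) * 2 ^ (n - (j + 1))) < baryArray n W A (j + 1) (2 * m + 1) ∧
      baryArray n W A (j + 1) (2 * m + 1) < A (i + (2 * m + 1) * 2 ^ (n - (j + 1))) := by
  intro i hi
  obtain ⟨h', rfl⟩ : ∃ h', n = j + (h' + 1) := ⟨n - j - 1, by omega⟩
  have hb := (h.block j hm).2.2
  have e1 : j + (h' + 1) - (j + 1) = h' := by omega
  have e2 : j + (h' + 1) - j = h' + 1 := by omega
  rw [e1] at hi ⊢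
  rw [baryArray_odd, e2]
  have := hb i hi
  rw [show i + 2 * m * 2 ^ h' = i + m * 2 ^ (h' + 1) by rw [pow_succ]; ring,
    show i + (2 * m + 1) * 2 ^ h' = i + 2 ^ h' + m * 2 ^ (h' + 1) by rw [pow_succ]; ring]
  exact this

/-- The barycenters of the two halves of a dyadic block are separated by that of the block. -/
lemma BarySplit.baryArray_halves {n j m : ℕ} {W A : ℕ → ℝ} (hW : ∀ i, 0 < W i)
    (h : BarySplit (· < ·) n W A) (hj : j < n) (hm : m < 2 ^ j) :
    baryArray n W A (j + 2) (2 * (2 * m) + 1) < baryArray n W A (j + 1) (2 * m + 1) ∧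
      baryArray n W A (j + 1) (2 * m + 1) < baryArray n W A (j + 2) (2 * (2 * m + 1) + 1) := by
  rw [baryArray_odd _ _ _ (j + 1), baryArray_odd _ _ _ (j + 1)]
  exact ⟨bary_lt (fun i => hW _) fun i hi => (h.baryArray_block hj hm i hi).1,
    lt_bary (fun i => hW _) fun i hi => (h.baryArray_block hj hm i hi).2⟩

/-- The inversion formula recovers the distribution function from the barycenter array. -/
lemma BarySplit.realInvCdf_baryArray {n : ℕ} {W A : ℕ → ℝ} (hW : ∀ i, 0 < W i)
    (h : BarySplit (· < ·) n W A) (hsum : ∑ i ∈ Finset.range (2 ^ n), W i = 1) (j : ℕ) :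
    j ≤ n → ∀ k ≤ 2 ^ j, realInvCdf (baryArray n W A) j k =
      ∑ i ∈ Finset.range (k * 2 ^ (n - j)), W i := by
  induction j with
  | zero =>
    intro _ k hk
    rcases Nat.le_one_iff_eq_zero_or_eq_one.1 (by simpa using hk) with rfl | rfl <;>
      simp [realInvCdf, hsum]
  | succ j ih =>
    intro hj k hk
    have hp : 2 ^ (j + 1) = 2 ^ j + 2 ^ j := by rw [pow_succ, mul_two]
    have e : n - j = n - (j + 1) + 1 := by omega
    rcases Nat.even_or_odd' k with ⟨m, rfl | rfl⟩
    · rw [realInvCdf, if_pos (by omega), Nat.mul_div_cancel_left _ (by norm_num),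
        ih (by omega) m (by omega), e, pow_succ]
      congr 2; ring
    · have hm : m < 2 ^ j := by omega
      obtain ⟨h1, h2⟩ := h.baryArray_halves hW (by omega) hm
      rw [realInvCdf, if_neg (by omega), show (2 * m + 1) / 2 = m by omega]
      simp only [Nat.add_sub_cancel]
      rw [show 4 * (m + 1) - 1 = 2 * (2 * m + 1) + 1 by omega,
        show 4 * (m + 1) - 2 = 2 * (2 * m + 1) by omega, baryArray_even,
        show 4 * (m + 1) - 3 = 2 * (2 * m) + 1 by omega, convRatio, if_neg (by linarith),
        ih (by omega) m (by omega), ih (by omega) (m + 1) (by omega),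
        sum_range_block, sum_range_block, add_sub_cancel_left]
      have hb : baryArray n W A (j + 1) (2 * m + 1) *
          ∑ i ∈ Finset.range (2 ^ (n - j)), W (i + m * 2 ^ (n - j)) =
          ∑ i ∈ Finset.range (2 ^ (n - j)),
            W (i + m * 2 ^ (n - j)) * A (i + m * 2 ^ (n - j)) := by
        rw [baryArray_odd, bary]
        exact div_mul_cancel₀ _ (sum_range_two_pow_pos (fun i => hW _) _).ne'
      have hc : ∀ l, baryArray n W A (j + 2) (2 * l + 1) *
          ∑ i ∈ Finset.range (2 ^ (n - (j + 1))), W (i + l * 2 ^ (n - (j + 1))) =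
          ∑ i ∈ Finset.range (2 ^ (n - (j + 1))),
            W (i + l * 2 ^ (n - (j + 1))) * A (i + l * 2 ^ (n - (j + 1))) := by
        intro l
        rw [baryArray_odd, bary]
        exact div_mul_cancel₀ _ (sum_range_two_pow_pos (fun i => hW _) _).ne'
      have hc1 := hc (2 * m)
      have hc2 := hc (2 * m + 1)
      rw [e] at hb ⊢
      have hd1 : ∀ i, i + m * 2 ^ (n - (j + 1) + 1) = i + 2 * m * 2 ^ (n - (j + 1)) := fun i => by
        rw [pow_succ]; ring
      have hd2 : ∀ i, i + 2 ^ (n - (j + 1)) + 2 * m * 2 ^ (n - (j + 1)) =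
          i + (2 * m + 1) * 2 ^ (n - (j + 1)) := fun i => by ring
      rw [show m * 2 ^ (n - (j + 1) + 1) = 2 * m * 2 ^ (n - (j + 1)) by rw [pow_succ]; ring]
      simp only [sum_range_two_pow_succ, hd1, hd2] at hb ⊢
      rw [← hc1, ← hc2] at hb
      congr 1
      -- With the denominators cleared, the claim is the balance of moments `hb`: the moment of a
      -- block is the sum of the moments of its halves.
      rw [mul_div_assoc', div_eq_iff (by linarith)]
      linear_combination -hb

/-- The entries of row `j` of the barycenter array separate the neighbouring blocks. -/
lemma BarySplit.baryArray_separates {n : ℕ} {W A : ℕ → ℝ} (h : BarySplit (· < ·) n W A) (j : ℕ) :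
    j ≤ n → ∀ l, l + 1 < 2 ^ j → ∀ i < 2 ^ (n - j),
      A (i + l * 2 ^ (n - j)) < baryArray n W A j (l + 1) ∧
      baryArray n W A j (l + 1) < A (i + (l + 1) * 2 ^ (n - j)) := by
  induction j with
  | zero => intro _ l hl; simp at hl
  | succ j ih =>
    intro hj l hl i hi
    have hp : 2 ^ (j + 1) = 2 ^ j + 2 ^ j := by rw [pow_succ, mul_two]
    have hq : 2 ^ (n - j) = 2 * 2 ^ (n - (j + 1)) := by
      rw [show n - j = n - (j + 1) + 1 by omega, pow_succ, mul_comm]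
    rcases Nat.even_or_odd' l with ⟨m, rfl | rfl⟩
    · exact h.baryArray_block (by omega) (by omega) i hi
    -- An inherited entry: the two neighbouring blocks are the right half of block `m` and the left
    -- half of block `m + 1` of the previous level.
    · rw [show 2 * m + 1 + 1 = 2 * (m + 1) by ring, baryArray_even]
      have h1 := (ih (by omega) m (by omega) (i + 2 ^ (n - (j + 1))) (by omega)).1
      have h2 := (ih (by omega) m (by omega) i (by omega)).2
      rw [hq] at h1 h2
      refine ⟨?_, ?_⟩
      · convert h1 using 2; ring
      · convert h2 using 2; ring

/-- The odd entries of row `j + 1` lie strictly between the neighbouring entries of row `j`. -/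
lemma BarySplit.baryArray_nested {n j l : ℕ} {W A : ℕ → ℝ} (hW : ∀ i, 0 < W i)
    (h : BarySplit (· < ·) n W A) (hj : j ≤ n) (hl : l < 2 ^ j) :
    (l ≠ 0 → baryArray n W A j l < baryArray n W A (j + 1) (2 * l + 1)) ∧
      (l + 1 ≠ 2 ^ j → baryArray n W A (j + 1) (2 * l + 1) < baryArray n W A j (l + 1)) := by
  rw [baryArray_odd]
  refine ⟨fun hl0 => lt_bary (fun i => hW _) fun i hi => ?_,
    fun hl1 => bary_lt (fun i => hW _) fun i hi => ?_⟩
  · obtain ⟨l, rfl⟩ := Nat.exists_eq_succ_of_ne_zero hl0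
    exact (h.baryArray_separates j hj l hl i hi).2
  · exact (h.baryArray_separates j hj l (by omega) i hi).1

lemma bary_mem {n : ℕ} {W A : ℕ → ℝ} (hW : ∀ i, 0 < W i) {s : Set ℝ} (hs : Convex ℝ s)
    (hA : ∀ i < 2 ^ n, A i ∈ s) : bary n W A ∈ s := by
  have := hs.centerMass_mem (t := Finset.range (2 ^ n)) (w := W) (z := A) (fun i _ => (hW i).le)
    (sum_range_two_pow_pos hW n) fun i hi => hA i (Finset.mem_range.1 hi)
  rwa [Finset.centerMass, smul_eq_mul, inv_mul_eq_div] at this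

lemma baryArray_mem {n : ℕ} {W A : ℕ → ℝ} (hW : ∀ i, 0 < W i) {s : Set ℝ} (hs : Convex ℝ s)
    (hA : ∀ i, A i ∈ s) (j : ℕ) : ∀ l, 0 < l → l < 2 ^ j → baryArray n W A j l ∈ s := by
  induction j with
  | zero => intro l h0 h1; simp at h1; omega
  | succ j ih =>
    intro l h0 h1
    have hp : 2 ^ (j + 1) = 2 ^ j + 2 ^ j := by rw [pow_succ, mul_two]
    rcases Nat.even_or_odd' l with ⟨m, rfl | rfl⟩
    · rw [baryArray_even]; exact ih m (by omega) (by omega)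
    · rw [baryArray_odd]; exact bary_mem (fun i => hW _) hs fun i _ => hA _

section

/-! ### Neighbourhoods of arrays -/

/-- The arrays whose entries in the rows `1, …, n + 1` are `ε`-close to those of `y`. -/
def arrayNhd (n : ℕ) (y : ℕ → ℕ → ℝ) (ε : ℝ) : Set (ℕ → ℕ → ℝ) :=
  {x | ∀ j ∈ Finset.Icc 1 (n + 1), ∀ l ∈ Finset.Ico 1 (2 ^ j), |x j l - y j l| < ε}

/-- The filter generated by the sets `arrayNhd n y ε`, `0 < ε`. -/
def arrayFilter (n : ℕ) (y : ℕ → ℕ → ℝ) : Filter (ℕ → ℕ → ℝ) :=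
  ⨅ ε ∈ Ioi (0 : ℝ), Filter.principal (arrayNhd n y ε)

lemma arrayFilter_hasBasis (n : ℕ) (y : ℕ → ℕ → ℝ) :
    (arrayFilter n y).HasBasis (fun ε : ℝ => ε ∈ Ioi (0 : ℝ)) (arrayNhd n y) := by
  refine Filter.hasBasis_biInf_principal (fun a ha b hb => ⟨min a b, mem_Ioi.2 (lt_min ha hb), ?_, ?_⟩)
    ⟨1, mem_Ioi.2 one_pos⟩
  · exact fun x hx j hj l hl => (hx j hj l hl).trans_le (min_le_left _ _)
  · exact fun x hx j hj l hl => (hx j hj l hl).trans_le (min_le_right _ _)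

lemma tendsto_entry {n : ℕ} (y : ℕ → ℕ → ℝ) {j l : ℕ} (hj : 1 ≤ j) (hj' : j ≤ n + 1)
    (hl : 1 ≤ l) (hl' : l < 2 ^ j) :
    Filter.Tendsto (fun x : ℕ → ℕ → ℝ => x j l) (arrayFilter n y) (nhds (y j l)) := by
  rw [(arrayFilter_hasBasis n y).tendsto_iff Metric.nhds_basis_ball]
  refine fun ε hε => ⟨ε, hε, fun x hx => ?_⟩
  rw [Metric.mem_ball, Real.dist_eq]
  exact hx j (Finset.mem_Icc.2 ⟨hj, hj'⟩) l (Finset.mem_Ico.2 ⟨hl, hl'⟩)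

lemma tendsto_convRatio {α : Type*} {F : Filter α} {f g : α → ℝ} {a b : ℝ}
    (hf : Filter.Tendsto f F (nhds a)) (hg : Filter.Tendsto g F (nhds b)) (hb : b ≠ 0) :
    Filter.Tendsto (fun x => convRatio (f x) (g x)) F (nhds (convRatio a b)) := by
  rw [convRatio, if_neg hb]
  refine (hf.div hg hb).congr' ?_
  filter_upwards [hg.eventually_ne hb] with x hx
  rw [convRatio, if_neg hx]
  rfl

/-- The inversion formula can be discontinuous only where a denominator vanishes; `hy` excludes this
at `y`, so the convention for `0 / 0` plays no role in the limit. -/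
lemma tendsto_realInvCdf {n : ℕ} {y : ℕ → ℕ → ℝ}
    (hy : ∀ j < n, ∀ m < 2 ^ j, y (j + 2) (4 * m + 1) ≠ y (j + 2) (4 * m + 3)) (j : ℕ) :
    j ≤ n → ∀ k ≤ 2 ^ j, Filter.Tendsto (fun x => realInvCdf x j k) (arrayFilter n y)
      (nhds (realInvCdf y j k)) := by
  induction j with
  | zero => intro _ k _; exact tendsto_const_nhds
  | succ j ih =>
    intro hj k hk
    have hp : 2 ^ (j + 1) = 2 ^ j + 2 ^ j := by rw [pow_succ, mul_two]
    have hp' : 2 ^ (j + 2) = 2 ^ j + 2 ^ j + (2 ^ j + 2 ^ j) := by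
      rw [pow_succ, pow_succ, mul_two, mul_two]
    simp only [realInvCdf]
    split_ifs with hk2
    · exact ih (by omega) _ (by omega)
    · obtain ⟨m, rfl⟩ : ∃ m, k = 2 * m + 1 := ⟨k / 2, by omega⟩
      rw [show (2 * m + 1) / 2 = m by omega]
      have h1 := ih (by omega) m (by omega)
      have h2 := ih (by omega) (m + 1) (by omega)
      have e := fun l (h : 1 ≤ l) (h' : l < 2 ^ (j + 2)) =>
        tendsto_entry (n := n) y (j := j + 2) (by omega) (by omega) h h'
      refine h1.add ((h2.sub h1).mul (tendsto_convRatio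
        ((e _ (by omega) (by omega)).sub (e _ (by omega) (by omega)))
        ((e _ (by omega) (by omega)).sub (e _ (by omega) (by omega))) ?_))
      rw [sub_ne_zero, show 4 * (m + 1) - 1 = 4 * m + 3 by omega,
        show 4 * (m + 1) - 3 = 4 * m + 1 by omega]
      exact (hy j (by omega) m (by omega)).symm

/-! ### The random array charges the neighbourhoods of nested arrays -/

/-- The two ends are treated apart because the cell is open on the left: in the first cell, `θ` must
lie strictly above `inf Θ`, which `h0'` certifies by a smaller point of `Θ`. -/
lemma mem_cell {Θ : Set ℝ} {x : ℕ → ℕ → Θ} {j l : ℕ} {θ : Θ} (hl : l < 2 ^ j)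
    (h0 : l ≠ 0 → (x j l : ℝ) < θ) (h0' : l = 0 → ∃ t : Θ, (t : ℝ) < θ)
    (h1 : l + 1 ≠ 2 ^ j → (θ : ℝ) ≤ x j (l + 1)) : θ ∈ cell x j (l + 1) := by
  constructor
  · rw [Nat.add_sub_cancel, extRow]
    split_ifs with h h'
    · obtain ⟨t, ht⟩ := h0' h
      exact (iInf_le _ t).trans_lt (EReal.coe_lt_coe_iff.2 ht)
    · omega
    · exact EReal.coe_lt_coe_iff.2 (h0 h)
  · rw [extRow, if_neg (by omega)]
    split_ifs with h
    · exact le_iSup (fun θ : Θ => ((θ : ℝ) : EReal)) θ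
    · exact EReal.coe_le_coe_iff.2 (h1 h)

lemma measurableSet_cell {Θ : Set ℝ} (x : ℕ → ℕ → Θ) (j l : ℕ) : MeasurableSet (cell x j l) := by
  have : Measurable fun θ : Θ => ((θ : ℝ) : EReal) := measurable_subtype_coe.coe_real_ereal
  exact (measurableSet_lt measurable_const this).inter (measurableSet_le this measurable_const)

lemma measure_abs_sub_lt_pos {Θ : Set ℝ} {μ : Measure Θ} (hμ : μ.support = univ) {y ε : ℝ}
    (hy : y ∈ Θ) (hε : 0 < ε) : 0 < μ {θ : Θ | |(θ : ℝ) - y| < ε} := by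
  have h : (⟨y, hy⟩ : Θ) ∈ μ.support := hμ ▸ mem_univ _
  rw [Measure.mem_support_iff_forall] at h
  refine h _ (IsOpen.mem_nhds ?_ (by simpa using hε))
  exact isOpen_lt (by fun_prop) continuous_const

/-- The event that row `j` of the random array is `ε`-close to that of `y`. -/
def rowNear {Ω : Type*} {Θ : Set ℝ} (M : Ω → ℕ → ℕ → Θ) (y : ℕ → ℕ → ℝ) (ε : ℝ) (j : ℕ) : Set Ω :=
  ⋂ l ∈ Finset.Ico 1 (2 ^ j), {ω | |(M ω j l : ℝ) - y j l| < ε}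

lemma mem_rowNear {Ω : Type*} {Θ : Set ℝ} {M : Ω → ℕ → ℕ → Θ} {y : ℕ → ℕ → ℝ} {ε : ℝ} {j : ℕ}
    {ω : Ω} : ω ∈ rowNear M y ε j ↔ ∀ l ∈ Finset.Ico 1 (2 ^ j), |(M ω j l : ℝ) - y j l| < ε := by
  simp [rowNear]

lemma measurableSet_abs_sub_lt {Θ : Set ℝ} (y ε : ℝ) : MeasurableSet {θ : Θ | |(θ : ℝ) - y| < ε} :=
  measurableSet_lt (by fun_prop) measurable_const

/-- The conditional law `cond_odd` applies only to events of the σ-algebra of the row, so ambient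
measurability would not be enough. -/
lemma measurableSet_rowNear {Ω : Type*} {Θ : Set ℝ} (M : Ω → ℕ → ℕ → Θ) (y : ℕ → ℕ → ℝ) (ε : ℝ) (j : ℕ) :
    MeasurableSet[rowSigma M j] (rowNear M y ε j) := by
  refine @Finset.measurableSet_biInter _ _ (rowSigma M j) _ _ fun l hl => ?_
  have : MeasurableSet[MeasurableSpace.comap (fun ω => M ω j l) inferInstance]
      {ω | |(M ω j l : ℝ) - y j l| < ε} :=
    ⟨_, measurableSet_abs_sub_lt (y j l) ε, rfl⟩
  exact (le_iSup₂ (f := fun l (_ : l ∈ Finset.Ico 1 (2 ^ j)) =>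
    MeasurableSpace.comap (fun ω => M ω j l) inferInstance) l hl) _ this

variable {Ω : Type*} [MeasurableSpace Ω] {Θ : Set ℝ} {P : Measure Ω} {n : ℕ}
  {H : ℕ → ℕ → ProbabilityMeasure Θ} {M : Ω → ℕ → ℕ → Θ} {y : ℕ → ℕ → ℝ} {ε : ℝ}

/-- Rows that are `ε`-close to `y` are so with positive probability, when `ε` is smaller than
half the gaps of the nested array `y`. -/
lemma IsRandomArray.measure_rowNear_pos (hM : IsRandomArray P n H M) (hε : 0 < ε)
    (hH : ∀ j ∈ Finset.Icc 1 (n + 1), ∀ l ∈ Finset.Icc 1 (2 ^ (j - 1)),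
      (H j (2 * l - 1) : Measure Θ).support = univ)
    (heven : ∀ j l, y (j + 1) (2 * l) = y j l)
    (hgap : ∀ j ≤ n, ∀ l < 2 ^ j, (l ≠ 0 → y j l + 2 * ε < y (j + 1) (2 * l + 1)) ∧
      (l + 1 ≠ 2 ^ j → y (j + 1) (2 * l + 1) + 2 * ε < y j (l + 1)))
    (hmem : ∀ j ≤ n, ∀ l < 2 ^ j, ∀ t, |t - y (j + 1) (2 * l + 1)| ≤ ε → t ∈ Θ) (j : ℕ) :
    j ≤ n → 0 < P (rowNear M y ε (j + 1)) := by
  have hpos : ∀ j ≤ n, ∀ l < 2 ^ j, 0 < (H (j + 1) (2 * l + 1) : Measure Θ)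
      {θ : Θ | |(θ : ℝ) - y (j + 1) (2 * l + 1)| < ε} := by
    intro j hj l hl
    refine measure_abs_sub_lt_pos ?_ (hmem j hj l hl _ (by simpa using hε.le)) hε
    have := hH (j + 1) (by simp [hj]) (l + 1) (by simp; omega)
    rwa [show 2 * (l + 1) - 1 = 2 * l + 1 by omega] at this
  induction j with
  | zero =>
    intro _
    have h := hpos 0 (Nat.zero_le _) 0 (by simp)
    simp only [zero_add, mul_zero] at h
    rw [← hM.law_root, Measure.map_apply (hM.measurable 1 (by simp) 1 (by simp))
      (measurableSet_abs_sub_lt _ _)] at h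
    convert h using 2
    ext ω
    simp [rowNear]
  | succ j ih =>
    intro hj
    set A := rowNear M y ε (j + 1) with hA
    have hAP : 0 < P A := ih (by omega)
    let B : ℕ → Set Θ := fun l => {θ | |(θ : ℝ) - y (j + 2) (2 * l - 1)| < ε}
    have hAm : MeasurableSet A := by
      refine Finset.measurableSet_biInter _ fun l hl => ?_
      exact measurableSet_lt (((hM.measurable (j + 1) (by simp; omega) l
        hl).subtype_val.sub_const _).abs) measurable_const
    have hcond := hM.cond_odd (j + 2) (by simp; omega) A (measurableSet_rowNear M y ε (j + 1)) B
      fun l => measurableSet_abs_sub_lt _ _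
    rw [show j + 2 - 1 = j + 1 by omega] at hcond
    -- On `A` the gap condition puts the target interval `B l` inside the random cell. Conditioning
    -- then divides its mass by the mass of the cell, which is at most one, so the unconditioned
    -- mass is a lower bound free of `ω`.
    have hbound : ∀ ω ∈ A, ∀ l ∈ Finset.Icc 1 (2 ^ (j + 1)),
        (H (j + 2) (2 * l - 1) : Measure Θ) (B l) ≤
          ProbabilityTheory.cond (H (j + 2) (2 * l - 1) : Measure Θ)
            (cell (M ω) (j + 1) l) (B l) := by
      intro ω hω l hl
      obtain ⟨hl1, hl2⟩ := Finset.mem_Icc.1 hl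
      obtain ⟨m, rfl⟩ := Nat.exists_eq_add_of_le' hl1
      simp only [hA, mem_rowNear, Finset.mem_Ico] at hω
      have hsub : B (m + 1) ⊆ cell (M ω) (j + 1) (m + 1) := by
        intro θ hθ
        change |(θ : ℝ) - y (j + 2) (2 * (m + 1) - 1)| < ε at hθ
        rw [show 2 * (m + 1) - 1 = 2 * m + 1 by omega] at hθ
        have hθ' := abs_lt.1 hθ
        obtain ⟨g1, g2⟩ := hgap (j + 1) hj m (by omega)
        refine mem_cell (by omega) (fun h => ?_) (fun h => ?_) (fun h => ?_)
        · have := abs_lt.1 (hω m ⟨by omega, by omega⟩)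
          linarith [g1 h]
        -- The left endpoint of the target interval belongs to `Θ`, since `hmem` covers the closed
        -- interval.
        · exact ⟨⟨y (j + 2) (2 * m + 1) - ε,
            hmem (j + 1) hj m (by omega) _ (by simp [abs_of_pos hε])⟩, by simp only; linarith⟩
        · have := abs_lt.1 (hω (m + 1) ⟨by omega, by omega⟩)
          linarith [g2 h]
      rw [ProbabilityTheory.cond_apply (measurableSet_cell _ _ _), inter_eq_self_of_subset_right hsub]
      refine le_mul_of_one_le_left' (ENNReal.one_le_inv.2 prob_le_one)
    have hc : 0 < ∏ l ∈ Finset.Icc 1 (2 ^ (j + 1)), (H (j + 2) (2 * l - 1) : Measure Θ) (B l) := by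
      rw [pos_iff_ne_zero, Finset.prod_ne_zero_iff]
      intro l hl
      obtain ⟨hl1, hl2⟩ := Finset.mem_Icc.1 hl
      obtain ⟨m, rfl⟩ := Nat.exists_eq_add_of_le' hl1
      have := hpos (j + 1) hj m (by omega)
      rw [show 2 * m + 1 = 2 * (m + 1) - 1 by omega] at this
      exact this.ne'
    have hlow : 0 < P (A ∩ ⋂ l ∈ Finset.Icc 1 (2 ^ (j + 1)), {ω | M ω (j + 2) (2 * l - 1) ∈ B l}) := by
      rw [hcond]
      refine (ENNReal.mul_pos hc.ne' hAP.ne').trans_le ?_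
      rw [← setLIntegral_const]
      exact setLIntegral_mono' hAm fun ω hω => Finset.prod_le_prod' fun l hl => hbound ω hω l hl
    refine hlow.trans_le (measure_mono_ae ?_)
    have hev : ∀ᵐ ω ∂P, ∀ l ∈ Finset.Ico 1 (2 ^ (j + 1)), M ω (j + 2) (2 * l) = M ω (j + 1) l := by
      rw [Finset.eventually_all]
      exact fun l hl => hM.even (j + 2) (by simp; omega) l hl
    filter_upwards [hev] with ω hω hmemω
    have h1 := hmemω.1
    have h2 := hmemω.2
    rw [hA, mem_rowNear] at h1
    rw [mem_iInter₂] at h2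
    refine mem_rowNear.2 ?_
    intro l hl
    obtain ⟨hl1, hl2⟩ := Finset.mem_Ico.1 hl
    have hp : 2 ^ (j + 1 + 1) = 2 ^ (j + 1) + 2 ^ (j + 1) := by rw [pow_succ, mul_two]
    rcases Nat.even_or_odd' l with ⟨m, rfl | rfl⟩
    · have hm : m ∈ Finset.Ico 1 (2 ^ (j + 1)) := Finset.mem_Ico.2 ⟨by omega, by omega⟩
      have := h1 m hm
      rwa [heven, hω m hm]
    · exact h2 (m + 1) (Finset.mem_Icc.2 ⟨by omega, by omega⟩)

/-- The random array is in each neighbourhood of a strictly nested array with positive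
probability. -/
lemma IsRandomArray.frequently_mem (hM : IsRandomArray P n H M)
    (hH : ∀ j ∈ Finset.Icc 1 (n + 1), ∀ l ∈ Finset.Icc 1 (2 ^ (j - 1)),
      (H j (2 * l - 1) : Measure Θ).support = univ)
    (heven : ∀ j l, y (j + 1) (2 * l) = y j l)
    (hgap : ∀ j ≤ n, ∀ l < 2 ^ j, (l ≠ 0 → y j l < y (j + 1) (2 * l + 1)) ∧
      (l + 1 ≠ 2 ^ j → y (j + 1) (2 * l + 1) < y j (l + 1)))
    (hmem : ∀ j ≤ n, ∀ l < 2 ^ j, y (j + 1) (2 * l + 1) ∈ interior Θ)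
    {s : Set (ℕ → ℕ → ℝ)} (hs : s ∈ arrayFilter n y) :
    ∃ᵐ ω ∂P, (fun j l => (M ω j l : ℝ)) ∈ s := by
  obtain ⟨δ, hδ, hδs⟩ := (arrayFilter_hasBasis n y).mem_iff.1 hs
  have key : ∀ᶠ ε in nhdsWithin (0 : ℝ) (Ioi 0), ∀ j ∈ Finset.range (n + 1),
      ∀ l ∈ Finset.range (2 ^ j), ((l ≠ 0 → y j l + 2 * ε < y (j + 1) (2 * l + 1)) ∧
      (l + 1 ≠ 2 ^ j → y (j + 1) (2 * l + 1) + 2 * ε < y j (l + 1))) ∧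
      ∀ t, |t - y (j + 1) (2 * l + 1)| ≤ ε → t ∈ Θ := by
    simp only [Finset.eventually_all]
    intro j hj l hl
    have hj : j ≤ n := by simpa [Nat.lt_succ_iff] using hj
    have hl : l < 2 ^ j := by simpa using hl
    have hgap' : ∀ a b : ℝ, a < b → ∀ᶠ ε in nhdsWithin (0 : ℝ) (Ioi 0), a + 2 * ε < b := by
      intro a b hab
      have : Filter.Tendsto (fun ε : ℝ => a + 2 * ε) (nhdsWithin 0 (Ioi 0)) (nhds a) := by
        have : Continuous fun ε : ℝ => a + 2 * ε := by fun_prop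
        simpa using (this.tendsto 0).mono_left nhdsWithin_le_nhds
      exact this.eventually_lt_const hab
    refine Filter.Eventually.and (Filter.Eventually.and ?_ ?_) ?_
    · by_cases h : l = 0
      · simp [h]
      · filter_upwards [hgap' _ _ ((hgap j hj l hl).1 h)] with ε hε _ using hε
    · by_cases h : l + 1 = 2 ^ j
      · simp [h]
      · filter_upwards [hgap' _ _ ((hgap j hj l hl).2 h)] with ε hε _ using hε
    · obtain ⟨r, hr, hrs⟩ := Metric.mem_nhds_iff.1 (mem_interior_iff_mem_nhds.1 (hmem j hj l hl))
      filter_upwards [nhdsWithin_le_nhds (Iio_mem_nhds hr)] with ε hε t ht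
      exact hrs (by rw [Metric.mem_ball, Real.dist_eq]; exact ht.trans_lt hε)
  obtain ⟨ε, hε⟩ := (key.and (Filter.Eventually.and self_mem_nhdsWithin
    (nhdsWithin_le_nhds (Iio_mem_nhds hδ)))).exists
  obtain ⟨hkey, hε0, hεδ⟩ := hε
  have hp := hM.measure_rowNear_pos (y := y) hε0 hH heven
    (fun j hj l hl => (hkey j (by simp; omega) l (by simpa using hl)).1)
    (fun j hj l hl => (hkey j (by simp; omega) l (by simpa using hl)).2) n le_rfl
  have hfreq : ∃ᵐ ω ∂P, ω ∈ rowNear M y ε (n + 1) := frequently_ae_mem_iff.2 hp.ne'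
  have hev : ∀ᵐ ω ∂P, ∀ j ∈ Finset.Icc 2 (n + 1), ∀ l ∈ Finset.Ico 1 (2 ^ (j - 1)),
      M ω j (2 * l) = M ω (j - 1) l := by
    simp only [Finset.eventually_all]
    exact hM.even
  refine (hfreq.and_eventually hev).mono fun ω hω => hδs ?_
  obtain ⟨hnear, hω⟩ := hω
  -- The last row contains all earlier ones at its even positions, so closeness passes down from row
  -- `n + 1`.
  have hrow : ∀ k ≤ n, ω ∈ rowNear M y ε (n + 1 - k) := by
    intro k
    induction k with
    | zero => exact fun _ => hnear
    | succ k ih =>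
      intro hk
      have h := ih (by omega)
      rw [mem_rowNear] at h ⊢
      intro l hl
      obtain ⟨j, hj⟩ : ∃ j, n + 1 - k = j + 1 := ⟨n - k, by omega⟩
      have hjk : n + 1 - (k + 1) = j := by omega
      rw [hj] at h
      rw [hjk] at hl ⊢
      have hp : 2 ^ (j + 1) = 2 ^ j + 2 ^ j := by rw [pow_succ, mul_two]
      obtain ⟨hl1, hl2⟩ := Finset.mem_Ico.1 hl
      have e := hω (j + 1) (by simp; omega) l (by simpa using hl)
      rw [Nat.add_sub_cancel] at e
      rw [← e, ← heven]
      exact h (2 * l) (Finset.mem_Ico.2 ⟨by omega, by omega⟩)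
  intro j hj l hl
  have hj' := Finset.mem_Icc.1 hj
  have := hrow (n + 1 - j) (by omega)
  rw [show n + 1 - (n + 1 - j) = j by omega] at this
  rw [mem_rowNear] at this
  exact (this l hl).trans hεδ

end

section

/-! ### Finitely supported probability measures -/

/-- Weights summing to `1` and points of `X`, both indexed by the finite type `ι`. -/
abbrev FinParam (ι : Type*) [Fintype ι] (X : Type*) : Type _ :=
  {q : (ι → NNReal) × (ι → X) // ∑ i, q.1 i = 1}

variable {ι : Type*} [Fintype ι] {Θ : Set ℝ}

/-- The probability measure `∑ i, w i • δ_{a i}`. -/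
noncomputable def finMeasure (q : FinParam ι Θ) : ProbabilityMeasure Θ :=
  ⟨∑ i, (q.1.1 i : ℝ≥0∞) • Measure.dirac (q.1.2 i), ⟨by
    have := congrArg ((↑) : NNReal → ℝ≥0∞) q.2
    simpa using this⟩⟩

lemma coe_finMeasure (q : FinParam ι Θ) :
    (finMeasure q : Measure Θ) = ∑ i, (q.1.1 i : ℝ≥0∞) • Measure.dirac (q.1.2 i) := rfl

lemma lintegral_finMeasure (q : FinParam ι Θ) (f : Θ → ℝ≥0∞) :
    ∫⁻ θ, f θ ∂(finMeasure q : Measure Θ) = ∑ i, (q.1.1 i : ℝ≥0∞) * f (q.1.2 i) := by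
  rw [coe_finMeasure, lintegral_finsetSum_measure]
  refine Finset.sum_congr rfl fun i _ => ?_
  rw [lintegral_smul_measure, lintegral_dirac, smul_eq_mul]

lemma continuous_finMeasure : Continuous (finMeasure : FinParam ι Θ → ProbabilityMeasure Θ) := by
  rw [ProbabilityMeasure.continuous_iff_forall_continuous_lintegral]
  intro f
  simp only [lintegral_finMeasure]
  have : Continuous fun q : FinParam ι Θ => ((∑ i, q.1.1 i * f (q.1.2 i) : NNReal) : ℝ≥0∞) := by
    refine ENNReal.continuous_coe.comp (continuous_finsetSum _ fun i _ => ?_)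
    fun_prop
  simpa using this

lemma lintegral_rpow_finMeasure_lt_top {p : ℝ} (hp : 1 ≤ p) (q : FinParam ι Θ) :
    ∫⁻ θ, ENNReal.ofReal |(θ : ℝ)| ^ p ∂(finMeasure q : Measure Θ) < ∞ := by
  rw [lintegral_finMeasure, ENNReal.sum_lt_top]
  exact fun i _ => ENNReal.mul_lt_top ENNReal.coe_lt_top
    (ENNReal.rpow_lt_top_of_nonneg (by linarith) ENNReal.ofReal_ne_top)

/-- The image of a probability measure under a simple function is finitely supported. -/
lemma exists_finMeasure_eq_map (ν : ProbabilityMeasure Θ) (T : SimpleFunc Θ Θ) :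
    ∃ q : FinParam T.range Θ, (finMeasure q : Measure Θ) = (ν : Measure Θ).map T := by
  have hw : ∀ x, ((ν (T ⁻¹' {x}) : NNReal) : ℝ≥0∞) = (ν : Measure Θ) (T ⁻¹' {x}) := fun x =>
    ProbabilityMeasure.ennreal_coeFn_eq_coeFn_toMeasure ν _
  have key : ∀ g : Θ → ℝ≥0∞, ∑ x : T.range, (ν (T ⁻¹' {x.1}) : ℝ≥0∞) * g x.1 =
      ∫⁻ θ, g (T θ) ∂(ν : Measure Θ) := by
    intro g
    have h := SimpleFunc.lintegral_eq_lintegral (T.map g) (ν : Measure Θ)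
    rw [SimpleFunc.map_lintegral] at h
    simp only [SimpleFunc.map_apply] at h
    refine Eq.trans ?_ h.symm
    rw [← Finset.sum_coe_sort T.range]
    exact Finset.sum_congr rfl fun x _ => by rw [hw, mul_comm]
  refine ⟨⟨(fun x => ν (T ⁻¹' {x.1}), fun x => x.1), ?_⟩, ?_⟩
  · have := key (fun _ => 1)
    simp only [mul_one, lintegral_const, measure_univ] at this
    exact_mod_cast this
  · refine Measure.ext fun s hs => ?_
    rw [← lintegral_indicator_one hs, lintegral_finMeasure, ← lintegral_indicator_one hs,
      lintegral_map (measurable_one.indicator hs) T.measurable]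
    exact key _

/-- Simple functions that approximate the identity of `Θ`. -/
noncomputable def approxId (θ₀ : Θ) (k : ℕ) : SimpleFunc Θ Θ :=
  SimpleFunc.approxOn id measurable_id univ θ₀ (mem_univ _) k

lemma tendsto_approxId (θ₀ θ : Θ) :
    Filter.Tendsto (fun k => approxId θ₀ k θ) Filter.atTop (nhds θ) :=
  SimpleFunc.tendsto_approxOn measurable_id (mem_univ _) (by simp)

lemma edist_approxId_le (θ₀ θ : Θ) (k : ℕ) : edist (approxId θ₀ k θ) θ ≤ edist θ₀ θ :=
  SimpleFunc.edist_approxOn_le measurable_id (mem_univ _) θ k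

/-- The images of `ν` under simple functions tending to the identity converge weakly to `ν`, by
dominated convergence. -/
lemma exists_finMeasure_mem (θ₀ : Θ) {U : Set (ProbabilityMeasure Θ)} (hU : IsOpen U)
    (hne : U.Nonempty) :
    ∃ (ι : Type) (_ : Fintype ι) (q : FinParam ι Θ), finMeasure q ∈ U := by
  obtain ⟨ν, hν⟩ := hne
  choose q hq using fun k => exists_finMeasure_eq_map ν (approxId θ₀ k)
  have hlim : Filter.Tendsto (fun k => finMeasure (q k)) Filter.atTop (nhds ν) := by
    rw [ProbabilityMeasure.tendsto_iff_forall_integral_tendsto]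
    intro f
    have e : ∀ k, ∫ θ, f θ ∂(finMeasure (q k) : Measure Θ) =
        ∫ θ, f (approxId θ₀ k θ) ∂(ν : Measure Θ) := fun k => by
      rw [hq k, integral_map (approxId θ₀ k).measurable.aemeasurable
        f.continuous.measurable.aestronglyMeasurable]
    simp only [e]
    refine tendsto_integral_of_dominated_convergence (fun _ => ‖f‖) (fun k => ?_)
      (integrable_const _) (fun k => Filter.Eventually.of_forall fun θ => f.norm_coe_le_norm _)
      (Filter.Eventually.of_forall fun θ => ?_)
    · exact (f.continuous.measurable.comp (approxId θ₀ k).measurable).aestronglyMeasurable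
    · exact (f.continuous.tendsto _).comp (tendsto_approxId θ₀ θ)
  obtain ⟨k, hk⟩ := (hlim.eventually (hU.mem_nhds hν)).exists
  exact ⟨_, inferInstance, q k, hk⟩

/-! ### Wasserstein estimates -/

lemma ofReal_abs_sub_eq_edist (x y : Θ) : ENNReal.ofReal |(x : ℝ) - (y : ℝ)| = edist x y := by
  rw [edist_dist, Subtype.dist_eq, Real.dist_eq]

lemma wasserstein_le {p : ℝ} {G₁ G₂ : ProbabilityMeasure Θ} (γ : Measure (Θ × Θ))
    (h₁ : γ.map Prod.fst = (G₁ : Measure Θ)) (h₂ : γ.map Prod.snd = (G₂ : Measure Θ)) :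
    wasserstein p G₁ G₂ ≤ (∫⁻ z, edist z.1 z.2 ^ p ∂γ) ^ (1 / p) := by
  simp only [wasserstein, ofReal_abs_sub_eq_edist]
  exact iInf₂_le γ ⟨h₁, h₂⟩

lemma rpow_one_div_lt {p : ℝ} (hp : 1 ≤ p) {a : ℝ≥0∞} {ε : ℝ} (h : a < ENNReal.ofReal ε ^ p) :
    a ^ (1 / p) < ENNReal.ofReal ε := by
  have hp0 : 0 < p := by linarith
  rw [one_div, ENNReal.rpow_inv_lt_iff hp0]
  exact h

/-- The transport cost between two finitely supported measures of a coupling that keeps as much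
mass as possible between points with the same index is at most this quantity. -/
noncomputable def finCost (p : ℝ) (q q₀ : FinParam ι Θ) : NNReal :=
  ∑ i, q₀.1.1 i * nndist (q.1.2 i) (q₀.1.2 i) ^ p +
    ∑ i, ∑ j, (q.1.1 i - q₀.1.1 i) * nndist (q.1.2 i) (q₀.1.2 j) ^ p

lemma continuous_finCost {p : ℝ} (hp : 1 ≤ p) (q₀ : FinParam ι Θ) :
    Continuous fun q : FinParam ι Θ => finCost p q q₀ := by
  have hp0 : 0 ≤ p := by linarith
  have hr : ∀ f : FinParam ι Θ → NNReal, Continuous f → Continuous fun q => f q ^ p := fun f hf =>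
    (NNReal.continuous_rpow_const hp0).comp hf
  unfold finCost
  refine (continuous_finsetSum _ fun i _ => continuous_const.mul (hr _ (by fun_prop))).add
    (continuous_finsetSum _ fun i _ => continuous_finsetSum _ fun j _ =>
      Continuous.mul (by fun_prop) (hr _ (by fun_prop)))

lemma finCost_self {p : ℝ} (hp : 1 ≤ p) (q₀ : FinParam ι Θ) : finCost p q₀ q₀ = 0 := by
  have : p ≠ 0 := by linarith
  simp [finCost, this]

/-- The coupling leaves the common mass `min (w i) (v i)` at index `i` and couples the excesses `w -
v` and `v - w` (truncated subtraction) as a normalized product. Bounding the product by its first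
marginal removes the division by the excess mass `r`, which makes `finCost` continuous. -/
lemma wasserstein_finMeasure_le {p : ℝ} (hp : 1 ≤ p) (q q₀ : FinParam ι Θ) :
    wasserstein p (finMeasure q) (finMeasure q₀) ≤ (finCost p q q₀ : ℝ≥0∞) ^ (1 / p) := by
  classical
  obtain ⟨⟨w, a⟩, hw⟩ := q
  obtain ⟨⟨v, b⟩, hv⟩ := q₀
  dsimp only at hw hv
  have hadd : ∀ i, min (w i) (v i) + (w i - v i) = w i := fun i => by
    rcases le_total (w i) (v i) with h | h <;> simp [h, tsub_eq_zero_of_le]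
  have hadd' : ∀ i, min (w i) (v i) + (v i - w i) = v i := fun i => by
    rcases le_total (w i) (v i) with h | h <;> simp [h, tsub_eq_zero_of_le]
  set r := ∑ i, (w i - v i) with hr
  have hr' : ∑ i, (v i - w i) = r := by
    have h1 : ∑ i, min (w i) (v i) + r = 1 := by
      rw [hr, ← Finset.sum_add_distrib, Finset.sum_congr rfl fun i _ => hadd i, hw]
    have h2 : ∑ i, min (w i) (v i) + ∑ i, (v i - w i) = 1 := by
      rw [← Finset.sum_add_distrib, Finset.sum_congr rfl fun i _ => hadd' i, hv]
    exact add_left_cancel (h2.trans h1.symm)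
  -- When `r = 0` the inverse is `0`, but then all excesses vanish as well.
  have hcancel : ∀ x ≤ r, r⁻¹ * x * r = x := fun x hx => by
    rcases eq_or_ne r 0 with h | h
    · simp [show x = 0 by simpa [h] using hx]
    · field_simp
  let K : ι → ι → NNReal := fun i j =>
    (if i = j then min (w i) (v i) else 0) + r⁻¹ * (w i - v i) * (v j - w j)
  have hrow : ∀ i, ∑ j, K i j = w i := fun i => by
    simp only [K, Finset.sum_add_distrib, ← Finset.mul_sum, hr']
    rw [hcancel _ (Finset.single_le_sum (f := fun i => w i - v i) (fun _ _ => zero_le)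
      (Finset.mem_univ i))]
    simpa using hadd i
  have hcol : ∀ j, ∑ i, K i j = v j := fun j => by
    simp only [K, Finset.sum_add_distrib, ← Finset.mul_sum, ← Finset.sum_mul, ← hr]
    rw [mul_right_comm, hcancel _ (hr' ▸ Finset.single_le_sum (f := fun i => v i - w i)
      (fun _ _ => zero_le) (Finset.mem_univ j))]
    simpa using hadd' j
  refine (wasserstein_le (∑ i, ∑ j, (K i j : ℝ≥0∞) • Measure.dirac (a i, b j)) ?_ ?_).trans ?_
  · refine Measure.ext fun s hs => ?_
    rw [Measure.map_apply measurable_fst hs, coe_finMeasure]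
    simp only [Measure.coe_finsetSum, Finset.sum_apply, Measure.smul_apply, smul_eq_mul,
      Measure.dirac_apply' _ (measurable_fst hs), Measure.dirac_apply' _ hs]
    refine Finset.sum_congr rfl fun i _ => ?_
    simp only [← hrow i, ENNReal.ofNNReal_finsetSum, Finset.sum_mul]
    rfl
  · refine Measure.ext fun s hs => ?_
    rw [Measure.map_apply measurable_snd hs, coe_finMeasure]
    simp only [Measure.coe_finsetSum, Finset.sum_apply, Measure.smul_apply, smul_eq_mul,
      Measure.dirac_apply' _ (measurable_snd hs), Measure.dirac_apply' _ hs]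
    rw [Finset.sum_comm]
    refine Finset.sum_congr rfl fun j _ => ?_
    simp only [← hcol j, ENNReal.ofNNReal_finsetSum, Finset.sum_mul]
    rfl
  · refine ENNReal.rpow_le_rpow ?_ (one_div_nonneg.2 (by linarith))
    have hcost : ∫⁻ z, edist z.1 z.2 ^ p ∂(∑ i, ∑ j, (K i j : ℝ≥0∞) • Measure.dirac (a i, b j)) =
        ((∑ i, ∑ j, K i j * nndist (a i) (b j) ^ p : NNReal) : ℝ≥0∞) := by
      rw [lintegral_finsetSum_measure, ENNReal.ofNNReal_finsetSum]
      refine Finset.sum_congr rfl fun i _ => ?_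
      rw [lintegral_finsetSum_measure, ENNReal.ofNNReal_finsetSum]
      refine Finset.sum_congr rfl fun j _ => ?_
      rw [lintegral_smul_measure, lintegral_dirac, smul_eq_mul, ENNReal.coe_mul,
        ENNReal.coe_rpow_of_nonneg _ (by linarith), edist_nndist]
    rw [hcost, ENNReal.coe_le_coe]
    simp only [K, finCost, add_mul, Finset.sum_add_distrib, ite_mul, zero_mul,
      Finset.sum_ite_eq, Finset.mem_univ, if_true]
    refine add_le_add (Finset.sum_le_sum fun i _ => ?_) (Finset.sum_le_sum fun i _ =>
      Finset.sum_le_sum fun j _ => ?_)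
    · exact mul_le_mul_left (min_le_right _ _) _
    · refine mul_le_mul_left ?_ _
      have hj : v j - w j ≤ r := hr' ▸ Finset.single_le_sum (f := fun i => v i - w i)
        (fun _ _ => zero_le) (Finset.mem_univ j)
      calc r⁻¹ * (w i - v i) * (v j - w j) ≤ r⁻¹ * (w i - v i) * r := mul_le_mul_right hj _
        _ = w i - v i := hcancel _ (Finset.single_le_sum (f := fun i => w i - v i)
          (fun _ _ => zero_le) (Finset.mem_univ i))

/-- Transport `ν` by a simple approximation of the identity and couple through its graph. The cost
is dominated by `edist θ₀ θ ^ p`, integrable by the moment condition, and tends to zero. -/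
lemma exists_wasserstein_finMeasure_lt (θ₀ : Θ) {p : ℝ} (hp : 1 ≤ p) (ν : Pp Θ p) {ε : ℝ}
    (hε : 0 < ε) : ∃ (ι : Type) (_ : Fintype ι) (q : FinParam ι Θ),
      wasserstein p (finMeasure q) ν.1 < ENNReal.ofReal ε := by
  have hp0 : 0 < p := by linarith
  have hmom : ∫⁻ θ, edist θ₀ θ ^ p ∂(ν.1 : Measure Θ) ≠ ∞ := by
    have hle : ∀ θ : Θ, edist θ₀ θ ^ p ≤ 2 ^ (p - 1) *
        (ENNReal.ofReal |(θ₀ : ℝ)| ^ p + ENNReal.ofReal |(θ : ℝ)| ^ p) := by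
      intro θ
      refine le_trans (ENNReal.rpow_le_rpow ?_ hp0.le) (ENNReal.rpow_add_le_mul_rpow_add_rpow _ _ hp)
      rw [← ofReal_abs_sub_eq_edist, ← ENNReal.ofReal_add (abs_nonneg _) (abs_nonneg _)]
      exact ENNReal.ofReal_le_ofReal (abs_sub _ _)
    refine ((lintegral_mono hle).trans_lt ?_).ne
    rw [lintegral_const_mul _ (by fun_prop), lintegral_add_left measurable_const]
    refine ENNReal.mul_lt_top (ENNReal.rpow_lt_top_of_nonneg (by linarith) (by simp))
      (ENNReal.add_lt_top.2 ⟨?_, ν.2⟩)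
    rw [lintegral_const, measure_univ, mul_one]
    exact ENNReal.rpow_lt_top_of_nonneg hp0.le ENNReal.ofReal_ne_top
  have hlim : Filter.Tendsto
      (fun k => ∫⁻ θ, edist (approxId θ₀ k θ) θ ^ p ∂(ν.1 : Measure Θ)) Filter.atTop
      (nhds 0) := by
    have := tendsto_lintegral_of_dominated_convergence (μ := (ν.1 : Measure Θ))
      (F := fun k θ => edist (approxId θ₀ k θ) θ ^ p) (f := fun _ => 0)
      (fun θ => edist θ₀ θ ^ p)
      (fun k => ((approxId θ₀ k).measurable.edist measurable_id).pow_const p)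
      (fun k => Filter.Eventually.of_forall fun θ =>
        ENNReal.rpow_le_rpow (edist_approxId_le θ₀ θ k) hp0.le) hmom
      (Filter.Eventually.of_forall fun θ => by
        have h := (tendsto_iff_edist_tendsto_0.1 (tendsto_approxId θ₀ θ)).ennrpow_const p
        rwa [ENNReal.zero_rpow_of_pos hp0] at h)
    simpa using this
  have hε' : 0 < ENNReal.ofReal ε ^ p :=
    ENNReal.rpow_pos (ENNReal.ofReal_pos.2 hε) ENNReal.ofReal_ne_top
  obtain ⟨k, hk⟩ := (hlim.eventually_lt_const hε').exists
  obtain ⟨q, hq⟩ := exists_finMeasure_eq_map ν.1 (approxId θ₀ k)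
  have hT : Measurable fun θ => (approxId θ₀ k θ, θ) :=
    (approxId θ₀ k).measurable.prodMk measurable_id
  refine ⟨_, inferInstance, q, (wasserstein_le ((ν.1 : Measure Θ).map fun θ =>
    (approxId θ₀ k θ, θ)) ?_ ?_).trans_lt (rpow_one_div_lt hp ?_)⟩
  · rw [Measure.map_map measurable_fst hT, hq]; rfl
  · rw [Measure.map_map measurable_snd hT]; exact Measure.map_id
  · rwa [lintegral_map (by fun_prop) hT]

/-! ### Finitely supported measures in the Wasserstein space -/

/-- A probability measure with finite `p`-th moment as an element of `P_p(Θ)`. -/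
def Pp.ofLt {p : ℝ} (ν : ProbabilityMeasure Θ)
    (h : ∫⁻ θ, ENNReal.ofReal |(θ : ℝ)| ^ p ∂(ν : Measure Θ) < ∞) : Pp Θ p := ⟨ν, h⟩

/-- The inclusion of `P_p(Θ)` in the set of probability measures has this left inverse. -/
noncomputable def toPp (p : ℝ) (d : Pp Θ p) (ν : ProbabilityMeasure Θ) : Pp Θ p :=
  open Classical in
  if h : ∫⁻ θ, ENNReal.ofReal |(θ : ℝ)| ^ p ∂(ν : Measure Θ) < ∞ then Pp.ofLt ν h else d

lemma toPp_finMeasure {p : ℝ} (hp : 1 ≤ p) (d : Pp Θ p) (q : FinParam ι Θ) :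
    (toPp p d (finMeasure q)).1 = finMeasure q := by
  rw [toPp, dif_pos (lintegral_rpow_finMeasure_lt_top hp q)]
  rfl

/-- An open set contains a ball around each of its points by definition, so a cost bound that
vanishes at each `q₀` is enough; no triangle inequality is needed. -/
lemma continuous_toPp_finMeasure {p : ℝ} (hp : 1 ≤ p) (d : Pp Θ p) :
    Continuous fun q : FinParam ι Θ => toPp p d (finMeasure q) := by
  refine ⟨fun U hU => isOpen_iff_mem_nhds.2 fun q₀ hq₀ => ?_⟩
  obtain ⟨ε, hε, hεU⟩ := hU _ hq₀
  have h := (ENNReal.continuous_coe.comp (continuous_finCost hp q₀)).tendsto q₀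
  rw [Function.comp_apply, finCost_self hp, ENNReal.coe_zero] at h
  have hε' : 0 < ENNReal.ofReal ε ^ p :=
    ENNReal.rpow_pos (ENNReal.ofReal_pos.2 hε) ENNReal.ofReal_ne_top
  filter_upwards [h.eventually_lt_const hε'] with q hq
  refine hεU _ ?_
  rw [toPp_finMeasure hp, toPp_finMeasure hp]
  exact (wasserstein_finMeasure_le hp q q₀).trans_lt (rpow_one_div_lt hp hq)

lemma exists_toPp_finMeasure_mem (θ₀ : Θ) {p : ℝ} (hp : 1 ≤ p) (d : Pp Θ p) {U : Set (Pp Θ p)}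
    (hU : IsOpen U) (hne : U.Nonempty) :
    ∃ (ι : Type) (_ : Fintype ι) (q : FinParam ι Θ), toPp p d (finMeasure q) ∈ U := by
  obtain ⟨ν, hν⟩ := hne
  obtain ⟨ε, hε, hεU⟩ := hU ν hν
  obtain ⟨ι, _, q, hq⟩ := exists_wasserstein_finMeasure_lt θ₀ hp ν hε
  exact ⟨ι, _, q, hεU _ (by rwa [toPp_finMeasure hp])⟩

end

section

/-! ### Barycenter arrays and finitely supported measures -/

variable {Θ : Set ℝ}

lemma sum_Icc_coe_eq_sum_range {α : Type*} [AddCommMonoid α] (N : ℕ) (f : ℕ → α) :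
    ∑ l : Finset.Icc 1 N, f (l.1 - 1) = ∑ i ∈ Finset.range N, f i := by
  rw [Finset.sum_coe_sort (Finset.Icc 1 N) (fun l => f (l - 1))]
  refine Finset.sum_nbij' (· - 1) (· + 1) ?_ ?_ ?_ ?_ ?_ <;> intro l hl <;>
    simp at hl ⊢ <;> omega

lemma finMeasure_apply {ι : Type*} [Fintype ι] (q : FinParam ι Θ) {s : Set Θ}
    (hs : MeasurableSet s) : (finMeasure q : Measure Θ) s =
      ENNReal.ofReal (∑ i, (q.1.1 i : ℝ) * (Subtype.val '' s).indicator 1 (q.1.2 i : ℝ)) := by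
  classical
  rw [← lintegral_indicator_one hs, lintegral_finMeasure, ENNReal.ofReal_sum_of_nonneg]
  · refine Finset.sum_congr rfl fun i _ => ?_
    rw [ENNReal.ofReal_mul NNReal.zero_le_coe, ENNReal.ofReal_coe_nnreal]
    congr 1
    by_cases h : q.1.2 i ∈ s <;> simp [indicator, h]
  · exact fun i _ => mul_nonneg NNReal.zero_le_coe (indicator_nonneg (by simp) _)

/-- Arbitrary test functions are allowed because the sums are finite; indicators of the images of
measurable sets give equality of the measures. -/
lemma finMeasure_eq {ι κ : Type*} [Fintype ι] [Fintype κ] {q : FinParam ι Θ} {q' : FinParam κ Θ}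
    (h : ∀ f : ℝ → ℝ, ∑ i, (q.1.1 i : ℝ) * f (q.1.2 i) = ∑ i, (q'.1.1 i : ℝ) * f (q'.1.2 i)) :
    finMeasure q = finMeasure q' := by
  refine Subtype.ext (Measure.ext fun s hs => ?_)
  exact (finMeasure_apply q hs).trans ((congrArg _ (h _)).trans (finMeasure_apply q' hs).symm)

lemma IsParameterSpace.convex (hΘ : IsParameterSpace Θ) : Convex ℝ Θ := hΘ.ordConnected.convex

/-- A convex set with nonempty interior lies in the closure of that interior. -/
lemma IsParameterSpace.dense_interior (hΘ : IsParameterSpace Θ) :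
    Dense {θ : Θ | (θ : ℝ) ∈ interior Θ} := by
  have hne : (interior Θ).Nonempty := by
    obtain ⟨a, ha, b, hb, hab⟩ := hΘ.nontrivial.exists_lt
    obtain ⟨c, hc⟩ := nonempty_Ioo.2 hab
    exact ⟨c, mem_interior.2 ⟨Ioo a b, fun x hx => hΘ.ordConnected.out ha hb (Ioo_subset_Icc_self hx),
      isOpen_Ioo, hc⟩⟩
  rw [Subtype.dense_iff]
  have e : Subtype.val '' {θ : Θ | (θ : ℝ) ∈ interior Θ} = interior Θ := by
    ext x
    simpa using fun h => interior_subset h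
  rw [e]
  exact subset_closure.trans
    (hΘ.convex.closure_interior_eq_closure_of_nonempty_interior hne).ge

/-- A finitely supported probability measure can be moved to the interior of `Θ`. -/
lemma IsParameterSpace.exists_interior_points (hΘ : IsParameterSpace Θ) {ι : Type*} [Fintype ι]
    {V : Set (FinParam ι Θ)} (hV : IsOpen V) {q : FinParam ι Θ} (hq : q ∈ V) :
    ∃ q' ∈ V, ∀ i, (q'.1.2 i : ℝ) ∈ interior Θ := by
  have hd : Dense (univ.pi fun _ : ι => {θ : Θ | (θ : ℝ) ∈ interior Θ}) :=
    dense_pi _ fun _ _ => hΘ.dense_interior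
  have hc : Continuous fun a : ι → Θ => (⟨(q.1.1, a), q.2⟩ : FinParam ι Θ) := by fun_prop
  obtain ⟨a, haV, ha⟩ := hd.inter_open_nonempty _ (hV.preimage hc) ⟨q.1.2, hq⟩
  exact ⟨_, haV, fun i => ha i (mem_univ i)⟩

/-- The finitely supported measure with the weights and the points of two sequences. -/
noncomputable def seqParam (n : ℕ) (W A : ℕ → ℝ) (hW : ∀ i, 0 < W i)
    (hsum : ∑ i ∈ Finset.range (2 ^ n), W i = 1) (hA : ∀ i, A i ∈ Θ) :
    FinParam (Finset.Icc 1 (2 ^ n)) Θ :=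
  ⟨(fun l => (W (l.1 - 1)).toNNReal, fun l => ⟨A (l.1 - 1), hA _⟩), by
    rw [← NNReal.coe_inj, NNReal.coe_sum]
    simp only [Real.coe_toNNReal _ (hW _).le, NNReal.coe_one]
    rw [sum_Icc_coe_eq_sum_range, hsum]⟩

/-- A finitely supported probability measure in the interior of `Θ` has a representation with
a weak barycenter splitting. -/
lemma exists_seqParam_eq {ι : Type*} [Fintype ι] (q : FinParam ι Θ)
    (hq : ∀ i, (q.1.2 i : ℝ) ∈ interior Θ) :
    ∃ (n : ℕ) (_ : 1 ≤ n) (s : Finset ℝ) (_ : (s : Set ℝ) ⊆ interior Θ) (W A : ℕ → ℝ)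
      (hW : ∀ i, 0 < W i) (hsum : ∑ i ∈ Finset.range (2 ^ n), W i = 1) (_ : ∀ i, A i ∈ s)
      (hA : ∀ i, A i ∈ Θ), BarySplit (· ≤ ·) n W A ∧
      finMeasure (seqParam n W A hW hsum hA) = finMeasure q := by
  classical
  obtain ⟨⟨w, a⟩, hw⟩ := q
  dsimp only at hw hq
  set t := Finset.univ.filter fun i => 0 < w i with ht
  set s := t.image fun i => (a i : ℝ) with hs
  -- Atoms of zero weight are dropped and coinciding atoms merged, so that the weights on `s` are
  -- positive.
  let v : ℝ → ℝ := fun x => ∑ i ∈ t with (a i : ℝ) = x, (w i : ℝ)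
  have htw : ∀ f : ι → ℝ, ∑ i ∈ t, (w i : ℝ) * f i = ∑ i, (w i : ℝ) * f i := fun f => by
    refine Finset.sum_subset (Finset.subset_univ _) fun i _ hi => ?_
    have : w i = 0 := by simpa [ht] using hi
    simp [this]
  have hv : ∀ f : ℝ → ℝ, ∑ x ∈ s, v x * f x = ∑ i, (w i : ℝ) * f (a i) := fun f => by
    rw [← htw, ← Finset.sum_fiberwise_of_maps_to (t := s) (g := fun i => (a i : ℝ))
      fun i hi => Finset.mem_image_of_mem _ hi]
    refine Finset.sum_congr rfl fun x _ => ?_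
    rw [Finset.sum_mul]
    exact Finset.sum_congr rfl fun i hi => by rw [(Finset.mem_filter.1 hi).2]
  have hw1 : ∑ i, (w i : ℝ) = 1 := by exact_mod_cast congrArg ((↑) : NNReal → ℝ) hw
  have hsne : s.Nonempty := by
    by_contra h
    have := hv fun _ => 1
    rw [Finset.not_nonempty_iff_eq_empty.1 h] at this
    simp [hw1] at this
  have hvpos : ∀ x ∈ s, 0 < v x := by
    intro x hx
    obtain ⟨i, hi, rfl⟩ := Finset.mem_image.1 hx
    exact Finset.sum_pos (fun j hj => by
      have := (Finset.mem_filter.1 (Finset.mem_filter.1 hj).1).2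
      exact_mod_cast this) ⟨i, Finset.mem_filter.2 ⟨hi, rfl⟩⟩
  have hsi : (s : Set ℝ) ⊆ interior Θ := by
    intro x hx
    obtain ⟨i, _, rfl⟩ := Finset.mem_image.1 (Finset.mem_coe.1 hx)
    exact hq i
  -- Depth `s.card - 1` would do for the splitting; one level more guarantees depth at least `1`.
  obtain ⟨W, A, hW, hA, hsp, hf⟩ := exists_barySplit s.card s v hsne (Nat.le_succ _) hvpos
  have hsum : ∑ i ∈ Finset.range (2 ^ s.card), W i = 1 := by
    have := (hf fun _ => 1).trans (hv fun _ => 1)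
    simpa [hw1] using this
  refine ⟨s.card, hsne.card_pos, s, hsi, W, A, hW, hsum, hA, fun i => interior_subset (hsi (hA i)),
    hsp, finMeasure_eq fun f => ?_⟩
  rw [← hv f, ← hf f]
  simp only [seqParam, Real.coe_toNNReal _ (hW _).le]
  exact sum_Icc_coe_eq_sum_range _ fun i => W i * f (A i)

/-- The measures of strictly nested barycenter arrays are dense in the finitely supported
measures. -/
lemma IsParameterSpace.exists_strict_seqParam (hΘ : IsParameterSpace Θ) {E : Type*}
    [TopologicalSpace E] {J : ProbabilityMeasure Θ → E}
    (hJ : ∀ (ι : Type) [Fintype ι], Continuous fun q : FinParam ι Θ => J (finMeasure q))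
    {U : Set E} (hU : IsOpen U) {ι : Type} [Fintype ι] {q : FinParam ι Θ}
    (hq : J (finMeasure q) ∈ U) :
    ∃ (n : ℕ) (_ : 1 ≤ n) (W A : ℕ → ℝ) (hW : ∀ i, 0 < W i)
      (hsum : ∑ i ∈ Finset.range (2 ^ n), W i = 1) (hA : ∀ i, A i ∈ interior Θ),
      BarySplit (· < ·) n W A ∧
      J (finMeasure (seqParam n W A hW hsum fun i => interior_subset (hA i))) ∈ U := by
  obtain ⟨q', hq', hint⟩ := hΘ.exists_interior_points (hU.preimage (hJ ι)) hq
  obtain ⟨n, hn, s, hs, W, A, hW, hsum, hAs, hA, hsp, heq⟩ := exists_seqParam_eq q' hint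
  have hmem : seqParam n W A hW hsum hA ∈
      (fun q : FinParam (Finset.Icc 1 (2 ^ n)) Θ => J (finMeasure q)) ⁻¹' U := by
    rw [mem_preimage, heq]; exact hq'
  obtain ⟨r, hr, hrU⟩ := Metric.isOpen_iff.1 (hU.preimage (hJ _)) _ hmem
  -- The finite support has a thickening inside the interior of `Θ`, so a small perturbation of the
  -- points stays there.
  obtain ⟨δ, hδ, hδs⟩ := s.finite_toSet.isCompact.exists_thickening_subset_open isOpen_interior hs
  obtain ⟨B, hB, hBs⟩ := hsp.exists_strict hW (min r δ / 2) (by positivity)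
  have hlt : min r δ / 2 < min r δ := half_lt_self (by positivity)
  have hBi : ∀ i, B i ∈ interior Θ := fun i => hδs (Metric.mem_thickening_iff.2
    ⟨A i, hAs i, by
      rw [Real.dist_eq]; exact (hB i).trans_lt (hlt.trans_le (min_le_right _ _))⟩)
  refine ⟨n, hn, W, B, hW, hsum, hBi, hBs, hrU ?_⟩
  rw [Metric.mem_ball, Subtype.dist_eq, Prod.dist_eq, max_lt_iff]
  refine ⟨by simpa [seqParam] using hr, (dist_pi_lt_iff hr).2 fun l => ?_⟩
  rw [Subtype.dist_eq, Real.dist_eq]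
  exact (hB _).trans_lt (hlt.trans_le (min_le_left _ _))

/-! ### The measure of an array -/

/-- The weights and the points of the measure attached to an array. -/
noncomputable def arrayParam (n : ℕ) (x : ℕ → ℕ → Θ) :
    (Finset.Icc 1 (2 ^ n) → NNReal) × (Finset.Icc 1 (2 ^ n) → Θ) :=
  (fun l => (weight x n l).toNNReal, fun l => x (n + 1) (2 * l - 1))

lemma arrayMeasure_eq_sum (n : ℕ) (x : ℕ → ℕ → Θ) :
    arrayMeasure n x = ∑ l, ((arrayParam n x).1 l : ℝ≥0∞) • Measure.dirac ((arrayParam n x).2 l) :=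
  (Finset.sum_coe_sort (Finset.Icc 1 (2 ^ n)) fun l =>
    ENNReal.ofReal (weight x n l) • Measure.dirac (x (n + 1) (2 * l - 1))).symm

/-- The normalization of the weights is read off from `ν` having total mass one. -/
lemma exists_finMeasure_arrayParam_eq {n : ℕ} {x : ℕ → ℕ → Θ} {ν : ProbabilityMeasure Θ}
    (h : (ν : Measure Θ) = arrayMeasure n x) :
    ∃ hx : ∑ l, (arrayParam n x).1 l = 1, ν = finMeasure ⟨arrayParam n x, hx⟩ := by
  rw [arrayMeasure_eq_sum] at h
  have hu : (ν : Measure Θ) univ = 1 := measure_univ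
  rw [h] at hu
  simp only [Measure.coe_finsetSum, Finset.sum_apply, Measure.smul_apply, measure_univ, smul_eq_mul,
    mul_one] at hu
  exact ⟨by exact_mod_cast hu, Subtype.ext h⟩

lemma measurable_convRatio {Ω : Type*} [MeasurableSpace Ω] {f g : Ω → ℝ} (hf : Measurable f)
    (hg : Measurable g) : Measurable fun ω => convRatio (f ω) (g ω) :=
  Measurable.ite (hg (measurableSet_singleton 0)) measurable_const (hf.div hg)

variable {Ω : Type*} [MeasurableSpace Ω] {P : Measure Ω} {n : ℕ}
  {H : ℕ → ℕ → ProbabilityMeasure Θ} {M : Ω → ℕ → ℕ → Θ}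

lemma IsRandomArray.measurable_invCdf (hM : IsRandomArray P n H M) (j : ℕ) :
    j ≤ n → ∀ k ≤ 2 ^ j, Measurable fun ω => invCdf (M ω) j k := by
  induction j with
  | zero => intro _ k _; exact measurable_const
  | succ j ih =>
    intro hj k hk
    have hp : 2 ^ (j + 1) = 2 ^ j + 2 ^ j := by rw [pow_succ, mul_two]
    have hp' : 2 ^ (j + 2) = 2 ^ j + 2 ^ j + (2 ^ j + 2 ^ j) := by
      rw [pow_succ, pow_succ, mul_two, mul_two]
    simp only [invCdf]
    split_ifs with hk2
    · exact ih (by omega) _ (by omega)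
    · have h1 := ih (by omega) (k / 2 + 1 - 1) (by omega)
      have h2 := ih (by omega) (k / 2 + 1) (by omega)
      have e := fun l (h : 1 ≤ l) (h' : l < 2 ^ (j + 2)) =>
        (hM.measurable (j + 2) (by simp; omega) l (Finset.mem_Ico.2 ⟨h, h'⟩)).subtype_val
      exact h1.add ((h2.sub h1).mul (measurable_convRatio
        ((e _ (by omega) (by omega)).sub (e _ (by omega) (by omega)))
        ((e _ (by omega) (by omega)).sub (e _ (by omega) (by omega)))))

lemma IsRandomArray.measurable_arrayParam (hM : IsRandomArray P n H M) :
    Measurable fun ω => arrayParam n (M ω) := by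
  have hp : 2 ^ (n + 1) = 2 ^ n + 2 ^ n := by rw [pow_succ, mul_two]
  refine Measurable.prodMk (measurable_pi_lambda _ fun l => ?_) (measurable_pi_lambda _ fun l => ?_)
  · have hl := Finset.mem_Icc.1 l.2
    exact ((hM.measurable_invCdf n le_rfl _ hl.2).sub
      (hM.measurable_invCdf n le_rfl _ (by omega))).real_toNNReal
  · have hl := Finset.mem_Icc.1 l.2
    exact hM.measurable _ (by simp) _ (Finset.mem_Ico.2 ⟨by omega, by omega⟩)

/-- Almost surely `G` factors through its weights and points, which are measurable in the array, and
`J` is continuous in them. Hence no regularity of the topology of `E` is needed. -/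
lemma IsDSBA.aemeasurable {G : Ω → ProbabilityMeasure Θ} (θ₀ : Θ) (hG : IsDSBA P n H G) {E : Type*}
    [TopologicalSpace E] {J : ProbabilityMeasure Θ → E}
    (hJ : ∀ (ι : Type) [Fintype ι], Continuous fun q : FinParam ι Θ => J (finMeasure q)) :
    @AEMeasurable Ω E (borel E) _ (fun ω => J (G ω)) P := by
  classical
  obtain ⟨M, hM, hGM⟩ := hG
  let _ : MeasurableSpace E := borel E
  have : BorelSpace E := ⟨rfl⟩
  -- A default with total weight one, used on the null set where the weights of the array need not
  -- sum to one.
  let d : (Finset.Icc 1 (2 ^ n) → NNReal) × (Finset.Icc 1 (2 ^ n) → Θ) :=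
    (Pi.single ⟨1, by simp [Nat.one_le_two_pow]⟩ 1, fun _ => θ₀)
  let g : Ω → (Finset.Icc 1 (2 ^ n) → NNReal) × (Finset.Icc 1 (2 ^ n) → Θ) := fun ω =>
    if ∑ l, (arrayParam n (M ω)).1 l = 1 then arrayParam n (M ω) else d
  have hg : Measurable g := by
    refine Measurable.ite ?_ hM.measurable_arrayParam measurable_const
    have : Measurable fun ω => ∑ l, (arrayParam n (M ω)).1 l :=
      Finset.measurable_sum _ fun l _ =>
        (measurable_pi_apply l).comp (measurable_fst.comp hM.measurable_arrayParam)
    exact this (measurableSet_singleton 1)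
  have hg1 : ∀ ω, ∑ l, (g ω).1 l = 1 := by
    intro ω
    by_cases h : ∑ l, (arrayParam n (M ω)).1 l = 1
    · simp only [g, h, if_true]
    · simp only [g, h, if_false, d]
      rw [Finset.sum_pi_single']
      simp
  refine ⟨fun ω => J (finMeasure ⟨g ω, hg1 ω⟩),
    (hJ _).measurable.comp (hg.subtype_mk (h := hg1)), ?_⟩
  filter_upwards [hGM] with ω hω
  obtain ⟨hx, h⟩ := exists_finMeasure_arrayParam_eq hω
  have e : g ω = arrayParam n (M ω) := if_pos hx
  simp only [e, h]

/-- The weights converge by continuity of the inversion formula, whose value at the barycenter array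
is the distribution function of `W`; the points are the odd entries of the last row, where blocks
are single points of `A`. -/
lemma tendsto_arrayParam {W A : ℕ → ℝ} (hW : ∀ i, 0 < W i)
    (hsum : ∑ i ∈ Finset.range (2 ^ n), W i = 1) (hA : ∀ i, A i ∈ Θ)
    (h : BarySplit (· < ·) n W A) :
    Filter.Tendsto (fun x : ℕ → ℕ → Θ => arrayParam n x)
      ((arrayFilter n (baryArray n W A)).comap fun x j l => (x j l : ℝ))
      (nhds (seqParam n W A hW hsum hA).1) := by
  have hp : 2 ^ (n + 1) = 2 ^ n + 2 ^ n := by rw [pow_succ, mul_two]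
  refine Filter.Tendsto.prodMk_nhds (tendsto_pi_nhds.2 fun l => ?_) (tendsto_pi_nhds.2 fun l => ?_)
  · have hl := Finset.mem_Icc.1 l.2
    obtain ⟨m, hm⟩ := Nat.exists_eq_add_of_le' hl.1
    have hy : ∀ j < n, ∀ m < 2 ^ j, baryArray n W A (j + 2) (4 * m + 1) ≠
        baryArray n W A (j + 2) (4 * m + 3) := by
      intro j hj m hm
      have := h.baryArray_halves hW hj hm
      rw [show 4 * m + 1 = 2 * (2 * m) + 1 by ring, show 4 * m + 3 = 2 * (2 * m + 1) + 1 by ring]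
      exact (this.1.trans this.2).ne
    have hc := fun k (hk : k ≤ 2 ^ n) => (tendsto_realInvCdf hy n le_rfl k hk).comp
      (Filter.tendsto_comap (f := fun (x : ℕ → ℕ → Θ) j l => (x j l : ℝ)))
    have hw := (hc l hl.2).sub (hc (l - 1) (by omega))
    rw [h.realInvCdf_baryArray hW hsum n le_rfl _ hl.2,
      h.realInvCdf_baryArray hW hsum n le_rfl _ (by omega)] at hw
    have e : ∑ i ∈ Finset.range (l * 2 ^ (n - n)), W i -
        ∑ i ∈ Finset.range ((l - 1) * 2 ^ (n - n)), W i = W (l.1 - 1) := by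
      rw [hm]; simp [Finset.sum_range_succ]
    rw [e] at hw
    refine (continuous_real_toNNReal.tendsto _).comp (hw.congr fun x => ?_)
    simp only [weight, invCdf_eq_realInvCdf, Function.comp_apply]
  · have hl := Finset.mem_Icc.1 l.2
    rw [tendsto_subtype_rng]
    have e := (tendsto_entry (n := n) (baryArray n W A) (j := n + 1) (l := 2 * l - 1) (by omega) le_rfl
      (by omega) (by omega)).comp
      (Filter.tendsto_comap (f := fun (x : ℕ → ℕ → Θ) j l => (x j l : ℝ)))
    rw [show 2 * l.1 - 1 = 2 * (l.1 - 1) + 1 by omega, baryArray_last hW] at e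
    refine e.congr fun x => ?_
    simp only [Function.comp_apply]
    rw [show 2 * (l.1 - 1) + 1 = 2 * l.1 - 1 by omega]

/-- A discrete SBA random measure charges the neighbourhoods of the measures of strictly nested
barycenter arrays. -/
lemma IsDSBA.frequently_mem (hΘ : IsParameterSpace Θ) {G : Ω → ProbabilityMeasure Θ}
    (hG : IsDSBA P n H G)
    (hH : ∀ j ∈ Finset.Icc 1 (n + 1), ∀ l ∈ Finset.Icc 1 (2 ^ (j - 1)),
      (H j (2 * l - 1) : Measure Θ).support = univ) {E : Type*}
    [TopologicalSpace E] {J : ProbabilityMeasure Θ → E}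
    (hJ : ∀ (ι : Type) [Fintype ι], Continuous fun q : FinParam ι Θ => J (finMeasure q))
    {W A : ℕ → ℝ} (hW : ∀ i, 0 < W i)
    (hsum : ∑ i ∈ Finset.range (2 ^ n), W i = 1) (hA : ∀ i, A i ∈ interior Θ)
    (h : BarySplit (· < ·) n W A) {U : Set E} (hU : IsOpen U)
    (hmem : J (finMeasure (seqParam n W A hW hsum fun i => interior_subset (hA i))) ∈ U) :
    ∃ᵐ ω ∂P, J (G ω) ∈ U := by
  obtain ⟨M, hM, hGM⟩ := hG
  have hnhds := (hU.preimage (hJ _)).mem_nhds hmem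
  rw [nhds_subtype_eq_comap, Filter.mem_comap] at hnhds
  obtain ⟨O, hO, hOU⟩ := hnhds
  obtain ⟨t, ht, htO⟩ := Filter.mem_comap.1
    (tendsto_arrayParam hW hsum (fun i => interior_subset (hA i)) h hO)
  have hfreq := hM.frequently_mem hH (fun j l => baryArray_even n W A j l)
    (fun j hj l hl => h.baryArray_nested hW hj hl)
    (fun j hj l hl => baryArray_mem hW hΘ.convex.interior hA (j + 1) _ (by omega)
      (by rw [pow_succ]; omega)) ht
  refine (hfreq.and_eventually hGM).mono fun ω hω => ?_
  obtain ⟨hx, hGω⟩ := exists_finMeasure_arrayParam_eq hω.2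
  rw [hGω]
  exact hOU (show _ ∈ O from htO hω.1)

end

/-! ### Full support -/

/-- A mixture over all depths of discrete SBA random measures with fully supported parameters has
full support in every space in which the finitely supported measures are dense and depend
continuously on their weights and points. -/
lemma hasFullSupport_of_dense {Θ : Set ℝ} (hΘ : IsParameterSpace Θ) (θ₀ : Θ) {Ω : Type*}
    [MeasurableSpace Ω] {P : Measure Ω} [IsProbabilityMeasure P] {N : Ω → ℕ} (hN : Measurable N)
    (hN_pos : ∀ᵐ ω ∂P, 1 ≤ N ω)
    {H : ℕ → ℕ → ℕ → ProbabilityMeasure Θ}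
    (hH : ∀ n : ℕ, 1 ≤ n → ∀ j ∈ Finset.Icc 1 (n + 1), ∀ l ∈ Finset.Icc 1 (2 ^ (j - 1)),
      (H n j (2 * l - 1) : Measure Θ).support = univ)
    {G : Ω → ProbabilityMeasure Θ}
    (hG : ∀ n : ℕ, 1 ≤ n → IsDSBA (ProbabilityTheory.cond P {ω | N ω = n}) n (H n) G)
    {E : Type*} [TopologicalSpace E] {J : ProbabilityMeasure Θ → E}
    (hJ : ∀ (ι : Type) [Fintype ι], Continuous fun q : FinParam ι Θ => J (finMeasure q))
    (hd : ∀ U : Set E, IsOpen U → U.Nonempty →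
      ∃ (ι : Type) (_ : Fintype ι) (q : FinParam ι Θ), J (finMeasure q) ∈ U) :
    HasFullSupport P fun ω => J (G ω) := by
  let _ : MeasurableSpace E := borel E
  have : BorelSpace E := ⟨rfl⟩
  have hNn : ∀ n, MeasurableSet {ω | N ω = n} := fun n => hN (measurableSet_singleton n)
  have hae : AEMeasurable (fun ω => J (G ω)) P := by
    have hun : (⋃ n, {ω | N ω = n}) = univ := by ext ω; simp
    rw [← Measure.restrict_univ (μ := P), ← hun, aemeasurable_iUnion_iff]
    intro n
    rcases Nat.eq_zero_or_pos n with rfl | hn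
    · have h0 : P {ω | N ω = 0} = 0 := by
        rw [← nonpos_iff_eq_zero, ← ae_iff.1 hN_pos]
        exact measure_mono fun ω (hω : N ω = 0) => by simp [hω]
      rw [Measure.restrict_eq_zero.2 h0]
      exact aemeasurable_zero_measure
    · have h := (hG n hn).aemeasurable θ₀ hJ
      rwa [ProbabilityTheory.cond, aemeasurable_smul_measure_iff] at h
      exact ENNReal.inv_ne_zero.2 (measure_ne_top _ _)
  refine ⟨hae, eq_univ_of_forall fun x => ?_⟩
  rw [Measure.mem_support_iff_forall]
  intro V hV
  obtain ⟨U, hUV, hU, hxU⟩ := mem_nhds_iff.1 hV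
  obtain ⟨ι, _, q, hq⟩ := hd U hU ⟨x, hxU⟩
  -- The depth of the splitting is the value of `N` on which to condition.
  obtain ⟨n, hn, W, A, hW, hsum, hA, hsp, hmem⟩ := hΘ.exists_strict_seqParam hJ hU hq
  have hfreq := (hG n hn).frequently_mem hΘ (hH n hn) hJ hW hsum hA hsp hU hmem
  refine lt_of_lt_of_le ?_ (measure_mono hUV)
  rw [Measure.map_apply_of_aemeasurable hae hU.measurableSet, pos_iff_ne_zero]
  exact frequently_ae_mem_iff.1
    (hfreq.filter_mono (ProbabilityTheory.cond_absolutelyContinuous.ae_le))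

lemma ae_of_ae_cond {Ω : Type*} [MeasurableSpace Ω] {P : Measure Ω} [IsFiniteMeasure P] {N : Ω → ℕ}
    (hN : Measurable N) (hN_pos : ∀ᵐ ω ∂P, 1 ≤ N ω) {p : Ω → Prop}
    (h : ∀ n : ℕ, 1 ≤ n → ∀ᵐ ω ∂(ProbabilityTheory.cond P {ω | N ω = n}), p ω) :
    ∀ᵐ ω ∂P, p ω := by
  have hall : ∀ᵐ ω ∂P, ∀ n : ℕ, 1 ≤ n → N ω = n → p ω := by
    rw [ae_all_iff]
    intro n
    by_cases hn : 1 ≤ n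
    · have hm : MeasurableSet {ω | N ω = n} := hN (measurableSet_singleton n)
      have := h n hn
      rw [ProbabilityTheory.cond, Measure.ae_ennreal_smul_measure_iff
        (ENNReal.inv_ne_zero.2 (measure_ne_top _ _)),
        ae_restrict_iff' hm] at this
      filter_upwards [this] with ω hω _ using hω
    · exact Filter.Eventually.of_forall fun ω h => absurd h hn
  filter_upwards [hall, hN_pos] with ω h1 h2 using h1 _ h2 rfl

end DSBA

theorem theorem4 {Θ : Set ℝ} (hΘ : DSBA.IsParameterSpace Θ)
    {Ω : Type*} [MeasurableSpace Ω] (P : Measure Ω) [IsProbabilityMeasure P]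
    -- the random depth, with full support on the positive integers
    (N : Ω → ℕ) (hN : Measurable N) (hN_pos : ∀ᵐ ω ∂P, 1 ≤ N ω)
    (hN_full : ∀ n : ℕ, 1 ≤ n → 0 < P {ω | N ω = n})
    -- the measures `H_{j,2l-1}` of the collection that belongs to the depth `n`
    (H : ℕ → ℕ → ℕ → ProbabilityMeasure Θ)
    (hH_ac : ∀ n : ℕ, 1 ≤ n → ∀ j ∈ Finset.Icc 1 (n + 1), ∀ l ∈ Finset.Icc 1 (2 ^ (j - 1)),
      (H n j (2 * l - 1) : Measure Θ) ≪
        (volume : Measure ℝ).comap Subtype.val)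
    (hH_supp : ∀ n : ℕ, 1 ≤ n → ∀ j ∈ Finset.Icc 1 (n + 1), ∀ l ∈ Finset.Icc 1 (2 ^ (j - 1)),
      (H n j (2 * l - 1) : Measure Θ).support = univ)
    -- given `N = n`, the random measure `G` is a DSBA with parameters `(n, H n)`
    (G : Ω → ProbabilityMeasure Θ)
    (hG : ∀ n : ℕ, 1 ≤ n →
      DSBA.IsDSBA (ProbabilityTheory.cond P {ω | N ω = n}) n (H n) G) :
    DSBA.HasFullSupport P G ∧
      ∀ p : ℝ, 1 ≤ p → ∃ Gp : Ω → DSBA.Pp Θ p,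
        (∀ᵐ ω ∂P, (Gp ω).1 = G ω) ∧ DSBA.HasFullSupport P Gp := by
  obtain ⟨θ, hθ⟩ := hΘ.nontrivial.nonempty
  refine ⟨DSBA.hasFullSupport_of_dense (J := id) hΘ ⟨θ, hθ⟩ hN hN_pos hH_supp hG
    (fun ι _ => DSBA.continuous_finMeasure) fun U hU hne =>
      DSBA.exists_finMeasure_mem ⟨θ, hθ⟩ hU hne, fun p hp => ?_⟩
  let δ : DSBA.FinParam Unit Θ := ⟨(fun _ => 1, fun _ => ⟨θ, hθ⟩), by simp⟩
  -- A point mass serves as the value of `Gp` wherever `G` has infinite `p`-th moment; almost surely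
  -- `G` is finitely supported, so this value is not used.
  let d : DSBA.Pp Θ p := DSBA.Pp.ofLt _ (DSBA.lintegral_rpow_finMeasure_lt_top hp δ)
  refine ⟨fun ω => DSBA.toPp p d (G ω), DSBA.ae_of_ae_cond hN hN_pos fun n hn => ?_,
    DSBA.hasFullSupport_of_dense hΘ ⟨θ, hθ⟩ hN hN_pos hH_supp hG
      (fun ι _ => DSBA.continuous_toPp_finMeasure hp d) fun U hU hne =>
        DSBA.exists_toPp_finMeasure_mem ⟨θ, hθ⟩ hp d hU hne⟩
  obtain ⟨M, -, hM⟩ := hG n hn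
  filter_upwards [hM] with ω hω
  obtain ⟨hx, h⟩ := DSBA.exists_finMeasure_arrayParam_eq hω
  rw [h]
  exact DSBA.toPp_finMeasure hp d _
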